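/- Let $R$ and $S$ be associative rings with identity and let ${}_RC_S$ be a semidualizing $(R,S)$-bimodule, i.e. ${}_RC$ and $C_S$ admit projective resolutions by finitely generated modules, the homothety maps $R\to\operatorname{Hom}_{S^{op}}(C,C)$ and $S\to\operatorname{Hom}_R(C,C)$ are isomorphisms, and $\operatorname{Ext}^{i}_R(C,C)=0=\operatorname{Ext}^{i}_{S^{op}}(C,C)$ for all $i\ge 1$. It is called faithfully semidualizing if, moreover, for $M\in\operatorname{Mod}R$ and $N\in\operatorname{Mod}S^{op}$, $\operatorname{Hom}_R(C,M)=0$ implies $M=0$, and $\operatorname{Hom}_{S^{op}}(C,N)=0$ implies $N=0$. Here $\operatorname{Mod}R$ denotes the category of left $R$-modules, and $\operatorname{Mod}S^{op}$ that of right $S$-modules. Let $\mathcal F_C(R)$ be the class of $C$-flat modules, that is, of left $R$-modules isomorphic to $C\otimes_SP$ with $P$ a flat left $S$-module; let $\mathcal C_C(R)$ be the class of $C$-cotorsion modules, that is, of left $R$-modules $A$ with $\operatorname{Ext}^i_R(Q,A)=0$ for all $Q\in\mathcal F_C(R)$ and all $i\ge1$; and let $\mathcal{PI}(R)$ be the class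 of pure injective left $R$-modules, that is, of those $E$ for which $\operatorname{Hom}_R(-,E)$ preserves the exactness of pure short exact sequences. (A short exact sequence of left $R$-modules is pure if $\operatorname{Hom}_R(M,-)$ preserves its exactness for every finitely presented $M$.) Assume that $S$ is right coherent. Then the following hold. 1. $\mathcal F_C(R)\cap\mathcal C_C(R)=\mathcal F_C(R)\cap\mathcal{PI}(R)$. 2. $\mathcal F_C(R)\cap\mathcal{PI}(R)$ is an injective cogenerator for $\mathcal F_C(R)$: for every $A\in\mathcal F_C(R)$ there is a short exact sequence $0\to A\to D\to A'\to 0$ with $D\in\mathcal F_C(R)\cap\mathcal{PI}(R)$ and $A'\in\mathcal F_C(R)$; and $\operatorname{Ext}_R^i(Q,D)=0$ for all $Q\in\mathcal F_C(R)$, $D\in\mathcal F_C(R)\cap\mathcal{PI}(R)$ and $i\ge 1$. 3. If $C$ is faithfully semidualizing, then $\mathcal F_C(R)\cap\mathcal{PI}(R)$ is preenveloping in $\operatorname{Mod}R$: for every left $R$-module $A$ there is a homomorphism $f\colon A\to D$ with $D\in\mathcal F_C(R)\cap\mathcal{PI}(R)$ such that every homomorphism from $A$ to a module in $\mathcal F_C(R)\cap\mathcal{PI}(R)$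 factors through $f$. -/

import Mathlib

open CategoryTheory CategoryTheory.Abelian
open scoped TensorProduct

universe u

namespace Semidualizing

/-! ### Tensor products over a noncommutative ring

Right `S`-modules are modules over `Sᵐᵒᵖ`, and an `(R, S)`-bimodule is an abelian group with
commuting actions of `R` and `Sᵐᵒᵖ`. -/

section Tensor

variable (R : Type*) (S : Type*) (C : Type*) (P : Type*) [Ring R] [Ring S]
  [AddCommGroup C] [Module R C] [Module Sᵐᵒᵖ C] [SMulCommClass R Sᵐᵒᵖ C]
  [AddCommGroup P] [Module S P]

/-- The relations `(c s) ⊗ p - c ⊗ (s p)` in `C ⊗ P` (tensor product over `ℤ`); their `R`-span is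
also their additive span, since `r ((c s) ⊗ p - c ⊗ (s p)) = ((r c) s) ⊗ p - (r c) ⊗ (s p)`. -/
def balancedRelations : Submodule R (C ⊗[ℤ] P) :=
  Submodule.span R {x | ∃ (c : C) (s : S) (p : P),
    x = (MulOpposite.op s • c) ⊗ₜ[ℤ] p - c ⊗ₜ[ℤ] (s • p)}

/-- The tensor product `C ⊗_S P` of an `(R, S)`-bimodule `C` and a left `S`-module `P`, as a left
`R`-module. For a mere right `S`-module, take `R = ℤ`. -/
abbrev BalancedTensor : Type _ := (C ⊗[ℤ] P) ⧸ balancedRelations R S C P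

end Tensor

/-- The additive map `f ⊗_S P : N ⊗_S P → N' ⊗_S P` induced by a map `f : N → N'` of right
`S`-modules. -/
def balancedTensorMap {S : Type*} [Ring S] {N N' : Type*} [AddCommGroup N] [Module Sᵐᵒᵖ N]
    [AddCommGroup N'] [Module Sᵐᵒᵖ N'] (f : N →ₗ[Sᵐᵒᵖ] N')
    (P : Type*) [AddCommGroup P] [Module S P] :
    BalancedTensor ℤ S N P →ₗ[ℤ] BalancedTensor ℤ S N' P :=
  Submodule.mapQ _ _ (TensorProduct.map f.toAddMonoidHom.toIntLinearMap LinearMap.id) <| by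
    rw [balancedRelations, Submodule.span_le]
    rintro _ ⟨c, s, p, rfl⟩
    refine Submodule.subset_span ⟨f c, s, p, ?_⟩
    simp

/-- A left `S`-module `P` is flat if `- ⊗_S P` preserves injections of right `S`-modules. -/
def IsFlat (S : Type u) [Ring S] (P : Type u) [AddCommGroup P] [Module S P] : Prop :=
  ∀ (N N' : Type u) [AddCommGroup N] [AddCommGroup N'] [Module Sᵐᵒᵖ N] [Module Sᵐᵒᵖ N']
    (f : N →ₗ[Sᵐᵒᵖ] N'), Function.Injective f → Function.Injective (balancedTensorMap f P)

/-- A ring is right coherent if its finitely generated right ideals are finitely presented right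
modules. -/
def IsRightCoherent (S : Type u) [Ring S] : Prop :=
  ∀ I : Submodule Sᵐᵒᵖ S, I.FG → Module.FinitePresentation Sᵐᵒᵖ I

/-! ### Subcategories of an abelian category -/

section Abelian

variable {A : Type*} [Category.{u} A] [Abelian A]

/-- `𝒳 ⊥ 𝒴`: all `Ext` groups of positive degree from objects of `𝒳` to objects of `𝒴` vanish. -/
def ExtOrthogonal [HasExt.{u} A] (𝒳 𝒴 : ObjectProperty A) : Prop :=
  ∀ X Y : A, 𝒳 X → 𝒴 Y → ∀ i : ℕ, 1 ≤ i → Subsingleton (Ext X Y i)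

/-- `𝒳^⊥`: the objects `Y` with `Ext^i(X, Y) = 0` for all `X` in `𝒳` and all `i ≥ 1`. -/
def rightPerp [HasExt.{u} A] (𝒳 : ObjectProperty A) : ObjectProperty A :=
  fun Y => ∀ X : A, 𝒳 X → ∀ i : ℕ, 1 ≤ i → Subsingleton (Ext X Y i)

/-- `𝒞 ⊆ 𝒳` is a cogenerator for `𝒳`: every `X` in `𝒳` fits into a short exact sequence
`0 → X → C → X' → 0` with `C` in `𝒞` and `X'` in `𝒳`. -/
def IsCogeneratorFor (𝒞 𝒳 : ObjectProperty A) : Prop :=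
  𝒞 ≤ 𝒳 ∧ ∀ X : A, 𝒳 X → ∃ (C X' : A) (f : X ⟶ C) (g : C ⟶ X') (w : f ≫ g = 0),
    (ShortComplex.mk f g w).ShortExact ∧ 𝒞 C ∧ 𝒳 X'

/-- `𝒞` is an injective cogenerator for `𝒳`. -/
def IsInjectiveCogeneratorFor [HasExt.{u} A] (𝒞 𝒳 : ObjectProperty A) : Prop :=
  IsCogeneratorFor 𝒞 𝒳 ∧ ExtOrthogonal 𝒳 𝒞

/-- `f : M ⟶ X` is an `𝒳`-preenvelope of `M`: `X` is in `𝒳` and every morphism from `M` to an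
object of `𝒳` factors through `f`. -/
def IsPreenvelope (𝒳 : ObjectProperty A) {M X : A} (f : M ⟶ X) : Prop :=
  𝒳 X ∧ ∀ (X' : A), 𝒳 X' → ∀ f' : M ⟶ X', ∃ h : X ⟶ X', f ≫ h = f'

/-- `𝒳` is preenveloping in the whole category: every object has an `𝒳`-preenvelope. -/
def IsPreenveloping (𝒳 : ObjectProperty A) : Prop :=
  ∀ M : A, ∃ (X : A) (f : M ⟶ X), IsPreenvelope 𝒳 f

end Abelian

/-! ### Purity -/

section Pure

variable {R : Type u} [Ring R]

/-- A short exact sequence of left `R`-modules is pure if `Hom_R(M, -)` keeps it exact for every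
finitely presented `M`. As `Hom_R(M, -)` is left exact, this says that maps lift. -/
def IsPureShortExact (E : ShortComplex (ModuleCat.{u} R)) : Prop :=
  E.ShortExact ∧ ∀ M : ModuleCat.{u} R, Module.FinitePresentation R M →
    ∀ g : M ⟶ E.X₃, ∃ h : M ⟶ E.X₂, h ≫ E.g = g

variable (R) in
/-- The pure injective modules `I`: `Hom_R(-, I)` keeps pure short exact sequences exact. As
`Hom_R(-, I)` is left exact, this says that maps extend. -/
def pureInjective : ObjectProperty (ModuleCat.{u} R) :=
  fun I => ∀ E : ShortComplex (ModuleCat.{u} R), IsPureShortExact E →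
    ∀ g : E.X₁ ⟶ I, ∃ h : E.X₂ ⟶ I, E.f ≫ h = g

end Pure

/-! ### Semidualizing bimodules -/

/-- A module admits a degreewise finite projective resolution: a projective resolution by
finitely generated modules. -/
def HasFiniteProjectiveResolution (R : Type u) [Ring R] (M : Type u) [AddCommGroup M]
    [Module R M] : Prop :=
  ∃ P : ProjectiveResolution (ModuleCat.of R M), ∀ n : ℕ, Module.Finite R (P.complex.X n)

section

variable (R S C : Type u) [Ring R] [Ring S] [AddCommGroup C] [Module R C] [Module Sᵐᵒᵖ C]
  [SMulCommClass R Sᵐᵒᵖ C]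

/-- The `(R, S)`-bimodule `C` is semidualizing. -/
structure IsSemidualizing : Prop where
  finite_left : HasFiniteProjectiveResolution R C
  finite_right : HasFiniteProjectiveResolution Sᵐᵒᵖ C
  /-- the homothety map `R → Hom_{Sᵒᵖ}(C, C)`, `r ↦ (c ↦ r c)`, is an isomorphism -/
  homothety_left : Function.Bijective
    (fun r : R => (DistribSMul.toLinearMap Sᵐᵒᵖ C r : C →ₗ[Sᵐᵒᵖ] C))
  /-- the homothety map `S → Hom_R(C, C)`, `s ↦ (c ↦ c s)`, is an isomorphism -/
  homothety_right : letI := SMulCommClass.symm R Sᵐᵒᵖ C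
    Function.Bijective
      (fun s : S => (DistribSMul.toLinearMap R C (MulOpposite.op s) : C →ₗ[R] C))
  ext_left : ∀ i : ℕ, 1 ≤ i → Subsingleton (Ext (ModuleCat.of R C) (ModuleCat.of R C) i)
  ext_right : ∀ i : ℕ, 1 ≤ i →
    Subsingleton (Ext (ModuleCat.of Sᵐᵒᵖ C) (ModuleCat.of Sᵐᵒᵖ C) i)

/-- The `(R, S)`-bimodule `C` is faithfully semidualizing. -/
structure IsFaithfullySemidualizing : Prop extends IsSemidualizing R S C where
  faithful_left : ∀ (M : Type u) [AddCommGroup M] [Module R M],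
    Subsingleton (C →ₗ[R] M) → Subsingleton M
  faithful_right : ∀ (N : Type u) [AddCommGroup N] [Module Sᵐᵒᵖ N],
    Subsingleton (C →ₗ[Sᵐᵒᵖ] N) → Subsingleton N

/-- `ℱ_C(R)`, the `C`-flat modules: the left `R`-modules isomorphic to `C ⊗_S P` for a flat left
`S`-module `P`. -/
def cFlat : ObjectProperty (ModuleCat.{u} R) :=
  fun M => ∃ P : ModuleCat.{u} S, IsFlat S P ∧ Nonempty (M ≃ₗ[R] BalancedTensor R S C P)

/-- `𝒞_C(R) = ℱ_C(R)^⊥`, the `C`-cotorsion modules. -/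
def cCotorsion : ObjectProperty (ModuleCat.{u} R) :=
  rightPerp (cFlat R S C)

end

end Semidualizing

/-! Write `P⁺` for the character module, the additive maps from `P` to ℚ/ℤ. The proof rests on the
evaluation embedding `P → P⁺⁺`. A module is flat iff its character module is injective
(`isFlat_iff_injective`), and over a right coherent ring the characters of an injective right module
form a flat module. So for flat `P` the module `P⁺⁺` is flat, and the triangle identity for
evaluation makes `P⁺⁺/P` flat as well (`isFlat_doubleDual_quotient`).

As `C` is finitely presented on the right, `C ⊗ P⁺⁺ ≅ (C ⊗ P)⁺⁺` (`btDoubleDual_bijective`). This is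
a character module, hence pure injective. Tensoring `0 → P → P⁺⁺ → P⁺⁺/P → 0` with `C` stays exact
and is even pure, because its cokernel is flat. This gives the cogenerator property.

For orthogonality, a map from a finitely presented module to `C ⊗ P` with `P` flat factors through a
finite power of `C` (`IsFlat.exists_factor`). Dimension shifting along the finitely presented
syzygies of `C` turns `Ext(C, C) = 0` into `Ext(C, C ⊗ P) = 0`. If `D = C ⊗ P` is pure injective, a
free presentation of a flat `Q` becomes a pure sequence after tensoring with `C`, so the vanishing
passes from `C` to `C ⊗ Q` (`IsFlat.subsingleton_ext_of_pureInjective`).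

The equality of the two classes follows: orthogonality is one inclusion, and a `C`-cotorsion
`C`-flat `D` splits off from the pure injective module of its cogenerator sequence.

For preenvelopes, each map `A → C ⊗ P` with `P` flat factors through `C ⊗ P₀` with `P₀` flat of
bounded size (`IsFlat.exists_small_factor`). The product of a set of such `P₀` is flat by coherence
and commutes with `C ⊗ -`. Embedding it in its double dual gives the preenvelope. -/

namespace Semidualizing

set_option linter.unusedSectionVars false

/-! ### Balanced tensor products: generators, universal property, right exactness -/

section TensorBasics

variable (R S : Type*) {C P P' X : Type*} [Ring R] [Ring S]
  [AddCommGroup C] [Module R C] [Module Sᵐᵒᵖ C] [SMulCommClass R Sᵐᵒᵖ C]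
  [AddCommGroup P] [Module S P] [AddCommGroup P'] [Module S P'] [AddCommGroup X]

/-- The class of `c ⊗ p` in `C ⊗_S P`. -/
def bt (c : C) (p : P) : BalancedTensor R S C P := Submodule.Quotient.mk (c ⊗ₜ[ℤ] p)

lemma bt_add_left (c c' : C) (p : P) : bt R S (c + c') p = bt R S c p + bt R S c' p := by
  simp [bt, TensorProduct.add_tmul]

lemma bt_add_right (c : C) (p p' : P) : bt R S c (p + p') = bt R S c p + bt R S c p' := by
  simp [bt, TensorProduct.tmul_add]

/-- The universal balanced biadditive map. -/
def btHom : C →+ P →+ BalancedTensor R S C P :=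
  AddMonoidHom.mk' (fun c => AddMonoidHom.mk' (bt R S c) (bt_add_right R S c))
    (fun c c' => by ext p; exact bt_add_left R S c c' p)

@[simp] lemma btHom_apply (c : C) (p : P) : btHom R S c p = bt R S c p := rfl

@[simp] lemma bt_zero_left (p : P) : bt R S (0 : C) p = 0 := by
  rw [← btHom_apply, map_zero]; rfl

@[simp] lemma bt_zero_right (c : C) : bt R S c (0 : P) = 0 := by
  rw [← btHom_apply, map_zero]

lemma bt_sum_left {ι : Type*} (s : Finset ι) (c : ι → C) (p : P) :
    bt R S (∑ i ∈ s, c i) p = ∑ i ∈ s, bt R S (c i) p := by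
  simp only [← btHom_apply, map_sum, AddMonoidHom.finsetSum_apply]

lemma bt_sum_right {ι : Type*} (s : Finset ι) (c : C) (p : ι → P) :
    bt R S c (∑ i ∈ s, p i) = ∑ i ∈ s, bt R S c (p i) := by
  simp only [← btHom_apply, map_sum]

lemma bt_smul_left (r : R) (c : C) (p : P) : bt R S (r • c) p = r • bt R S c p := rfl

lemma bt_balanced (c : C) (s : S) (p : P) :
    bt R S (MulOpposite.op s • c) p = bt R S c (s • p) :=
  (Submodule.Quotient.eq _).2 (Submodule.subset_span ⟨c, s, p, rfl⟩)

lemma btHom_balanced (c : C) (s : S) (p : P) :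
    btHom R S (MulOpposite.op s • c) p = btHom R S c (s • p) :=
  bt_balanced R S c s p

lemma bt_induction {motive : BalancedTensor R S C P → Prop} (zero : motive 0)
    (bt : ∀ c p, motive (bt R S c p)) (add : ∀ x y, motive x → motive y → motive (x + y))
    (t : BalancedTensor R S C P) : motive t := by
  obtain ⟨t, rfl⟩ := Submodule.Quotient.mk_surjective _ t
  induction t using TensorProduct.induction_on with
  | zero => exact zero
  | tmul c p => exact bt c p
  | add x y hx hy => exact add _ _ hx hy

lemma exists_sum_bt (t : BalancedTensor R S C P) :
    ∃ (n : ℕ) (c : Fin n → C) (p : Fin n → P), t = ∑ k, bt R S (c k) (p k) := by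
  induction t using bt_induction with
  | zero => exact ⟨0, Fin.elim0, Fin.elim0, by simp⟩
  | bt c p => exact ⟨1, fun _ => c, fun _ => p, by simp⟩
  | add x y hx hy =>
    obtain ⟨n, c, p, rfl⟩ := hx
    obtain ⟨m, d, q, rfl⟩ := hy
    exact ⟨n + m, Fin.append c d, Fin.append p q, by simp [Fin.sum_univ_add]⟩

variable {R S}

lemma bt_hom_ext {f g : BalancedTensor R S C P →+ X}
    (h : ∀ c p, f (bt R S c p) = g (bt R S c p)) : f = g := by
  ext t
  induction t using bt_induction with
  | zero => simp
  | bt c p => exact h c p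
  | add x y hx hy => rw [map_add, map_add, hx, hy]

variable (R) in
/-- Balanced biadditive maps lift to the tensor product. -/
noncomputable def btLift (B : C →+ P →+ X)
    (hB : ∀ (c : C) (s : S) (p : P), B (MulOpposite.op s • c) p = B c (s • p)) :
    BalancedTensor R S C P →+ X :=
  (balancedRelations R S C P).mkQ.toAddMonoidHom.liftOfSurjective
    (Submodule.mkQ_surjective _)
    ⟨TensorProduct.liftAddHom B (fun n c p => by simp), by
      intro t ht
      replace ht : t ∈ balancedRelations R S C P := by
        rw [AddMonoidHom.mem_ker] at ht
        exact (Submodule.Quotient.mk_eq_zero _).1 ht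
      rw [balancedRelations, Submodule.mem_span_set'] at ht
      obtain ⟨n, r, x, rfl⟩ := ht
      rw [AddMonoidHom.mem_ker, map_sum]
      refine Finset.sum_eq_zero fun i _ => ?_
      obtain ⟨c, s, p, h⟩ := (x i).2
      -- Scalars from `R` are absorbed into `c`, so an additive map need only kill the basic
      -- relations.
      have h' : r i • ((MulOpposite.op s • c) ⊗ₜ[ℤ] p - c ⊗ₜ[ℤ] (s • p)) =
          (MulOpposite.op s • (r i • c)) ⊗ₜ[ℤ] p - (r i • c) ⊗ₜ[ℤ] (s • p) := by
        rw [smul_sub, TensorProduct.smul_tmul', TensorProduct.smul_tmul', smul_comm]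
      rw [h, h', map_sub]
      simp [hB]⟩

@[simp] lemma btLift_bt (B : C →+ P →+ X)
    (hB : ∀ (c : C) (s : S) (p : P), B (MulOpposite.op s • c) p = B c (s • p)) (c : C) (p : P) :
    btLift R B hB (bt R S c p) = B c p := by
  refine (AddMonoidHom.liftOfRightInverse_comp_apply
    (balancedRelations R S C P).mkQ.toAddMonoidHom _
    (Function.rightInverse_surjInv (Submodule.mkQ_surjective (balancedRelations R S C P)))
    _ (c ⊗ₜ[ℤ] p)).trans ?_
  simp

variable (R) in
/-- Balanced biadditive maps that are `R`-linear in the first variable lift to `R`-linear maps. -/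
noncomputable def btLiftₗ [Module R X] (B : C →+ P →+ X)
    (hB : ∀ (c : C) (s : S) (p : P), B (MulOpposite.op s • c) p = B c (s • p))
    (hR : ∀ (r : R) (c : C) (p : P), B (r • c) p = r • B c p) :
    BalancedTensor R S C P →ₗ[R] X :=
  { btLift R B hB with
    map_smul' := fun r t => by
      change btLift R B hB _ = r • btLift R B hB _
      induction t using bt_induction with
      | zero => simp
      | bt c p => rw [← bt_smul_left, btLift_bt, btLift_bt, hR]
      | add x y hx hy => rw [smul_add, map_add, map_add, hx, hy, smul_add] }

@[simp] lemma btLiftₗ_bt [Module R X] (B : C →+ P →+ X)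
    (hB : ∀ (c : C) (s : S) (p : P), B (MulOpposite.op s • c) p = B c (s • p))
    (hR : ∀ (r : R) (c : C) (p : P), B (r • c) p = r • B c p) (c : C) (p : P) :
    btLiftₗ R B hB hR (bt R S c p) = B c p :=
  btLift_bt B hB c p

lemma bt_linearMap_ext [Module R X] {f g : BalancedTensor R S C P →ₗ[R] X}
    (h : ∀ c p, f (bt R S c p) = g (bt R S c p)) : f = g := by
  refine LinearMap.ext fun t => ?_
  exact DFunLike.congr_fun (bt_hom_ext (f := f.toAddMonoidHom) (g := g.toAddMonoidHom) h) t

variable (R C) in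
/-- The map `C ⊗_S g`. -/
noncomputable def btMap (g : P →ₗ[S] P') : BalancedTensor R S C P →ₗ[R] BalancedTensor R S C P' :=
  btLiftₗ R (AddMonoidHom.mk' (fun c => (btHom R S c).comp g.toAddMonoidHom)
      (fun c c' => by ext p; simp))
    (fun c s p => by simp [bt_balanced]) (fun r c p => by simp [bt_smul_left])

@[simp] lemma btMap_bt (g : P →ₗ[S] P') (c : C) (p : P) :
    btMap R C g (bt R S c p) = bt R S c (g p) := by
  simp [btMap]

@[simp] lemma balancedTensorMap_bt {N N' : Type*} [AddCommGroup N] [Module Sᵐᵒᵖ N]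
    [AddCommGroup N'] [Module Sᵐᵒᵖ N'] (f : N →ₗ[Sᵐᵒᵖ] N') (n : N) (p : P) :
    balancedTensorMap f P (bt ℤ S n p) = bt ℤ S (f n) p := by
  simp [balancedTensorMap, bt]

variable (R S) in
/-- Forgetting the left action on the tensor product. -/
noncomputable def btForget : BalancedTensor R S C P ≃+ BalancedTensor ℤ S C P :=
  AddMonoidHom.toAddEquiv (btLift R (btHom ℤ S) (btHom_balanced ℤ S))
    (btLift ℤ (btHom R S) (btHom_balanced R S))
    (bt_hom_ext (by simp)) (bt_hom_ext (by simp))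

@[simp] lemma btForget_bt (c : C) (p : P) : btForget R S (bt R S c p) = bt ℤ S c p := by
  simp [btForget]

lemma btMap_surjective {g : P →ₗ[S] P'} (hg : Function.Surjective g) :
    Function.Surjective (btMap R C g) := by
  intro t
  induction t using bt_induction with
  | zero => exact ⟨0, map_zero _⟩
  | bt c p =>
    obtain ⟨q, rfl⟩ := hg p
    exact ⟨bt R S c q, by simp⟩
  | add x y hx hy =>
    obtain ⟨x, rfl⟩ := hx
    obtain ⟨y, rfl⟩ := hy
    exact ⟨x + y, map_add _ _ _⟩

/-- Right exactness of the tensor product. -/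
lemma btMap_exact {K F Q : Type*} [AddCommGroup K] [Module S K] [AddCommGroup F] [Module S F]
    [AddCommGroup Q] [Module S Q] {i : K →ₗ[S] F} {g : F →ₗ[S] Q}
    (hg : Function.Surjective g) (hex : Function.Exact i g) :
    Function.Exact (btMap R C i) (btMap R C g) := by
  intro t
  constructor
  · intro ht
    have key : ∀ q, g (Function.surjInv hg q) = q := Function.surjInv_eq hg
    have hzero : ∀ (c : C) (f f' : F), g f = g f' →
        (LinearMap.range (btMap R C i)).mkQ (bt R S c f) =
          (LinearMap.range (btMap R C i)).mkQ (bt R S c f') := by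
      intro c f f' h
      obtain ⟨k, hk⟩ := (hex (f - f')).1 (by rw [map_sub, h, sub_self])
      refine (Submodule.Quotient.eq _).2 ⟨bt R S c k, ?_⟩
      rw [btMap_bt, hk, eq_sub_iff_add_eq, ← bt_add_right, sub_add_cancel]
    -- A left inverse of the map that `C ⊗ g` induces on the quotient by the image: `c ⊗ q` goes to
    -- the class of `c ⊗ f` for a chosen lift `f` of `q`. By `hzero` the choice does not matter.
    let Λ : BalancedTensor R S C Q →+ (BalancedTensor R S C F ⧸ LinearMap.range (btMap R C i)) :=
      btLift R (AddMonoidHom.mk' (fun c => AddMonoidHom.mk'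
        (fun q => (LinearMap.range (btMap R C i)).mkQ (bt R S c (Function.surjInv hg q)))
        (fun q q' => by
          rw [← map_add, ← bt_add_right]
          exact hzero _ _ _ (by simp [key])))
        (fun c c' => by ext q; simp [bt_add_left]))
        (fun c s p => by
          simp only [AddMonoidHom.mk'_apply, bt_balanced]
          exact hzero _ _ _ (by simp [key]))
    have hΛ : ∀ t, Λ (btMap R C g t) = (LinearMap.range (btMap R C i)).mkQ t := by
      intro t
      induction t using bt_induction with
      | zero => simp
      | bt c p =>
        simp only [Λ, btMap_bt, btLift_bt, AddMonoidHom.mk'_apply]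
        exact hzero _ _ _ (by simp [key])
      | add x y hx hy => rw [map_add, map_add, map_add, hx, hy]
    have := hΛ t
    rw [ht, map_zero] at this
    exact (Submodule.Quotient.mk_eq_zero _).1 this.symm
  · rintro ⟨t, rfl⟩
    induction t using bt_induction with
    | zero => simp
    | bt c p => simp [hex.apply_apply_eq_zero]
    | add x y hx hy => rw [map_add, map_add, hx, hy, add_zero]

end TensorBasics

/-! ### When a tensor vanishes -/

section Vanishing

variable {R S C P : Type*} [Ring R] [Ring S]
  [AddCommGroup C] [Module R C] [Module Sᵐᵒᵖ C] [SMulCommClass R Sᵐᵒᵖ C]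
  [AddCommGroup P] [Module S P]

lemma exists_addMonoidHom_factor {A B X : Type*} [AddCommGroup A] [AddCommGroup B]
    [AddCommGroup X] {f : A →+ B} (hf : Function.Surjective f) (g : A →+ X)
    (h : ∀ a, f a = 0 → g a = 0) : ∃ k : B →+ X, ∀ a, k (f a) = g a :=
  ⟨f.liftOfRightInverse _ (Function.rightInverse_surjInv hf) ⟨g, fun a ha => h a ha⟩,
    fun a => AddMonoidHom.liftOfRightInverse_comp_apply f _
      (Function.rightInverse_surjInv hf) ⟨g, fun a ha => h a ha⟩ a⟩

/-- The vector `κ q` with entries `κ i • q`. -/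
noncomputable def colSMul (S : Type*) {ι P : Type*} [Ring S] [AddCommGroup P] [Module S P] :
    (ι →₀ S) →+ P →+ (ι →₀ P) :=
  (AddMonoidHom.mk' (fun q => Finsupp.mapRange.addMonoidHom ((smulAddHom S P).flip q))
    (fun q q' => by ext; simp)).flip

@[simp] lemma colSMul_apply {ι : Type*} (κ : ι →₀ S) (q : P) (i : ι) :
    colSMul S κ q i = κ i • q := by
  simp [colSMul]

/-- The combination `∑ x i κ i` with coefficients on the right. -/
noncomputable def rightComb {ι : Type*} (S : Type*) [Ring S] [Module Sᵐᵒᵖ C] (x : ι → C) :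
    (ι →₀ S) →+ C :=
  Finsupp.liftAddHom fun i =>
    AddMonoidHom.mk' (fun s => MulOpposite.op s • x i) fun s t => by simp [add_smul]

lemma rightComb_apply {ι : Type*} (x : ι → C) (κ : ι →₀ S) :
    rightComb S x κ = κ.sum fun i s => MulOpposite.op s • x i := rfl

@[simp] lemma rightComb_single {ι : Type*} (x : ι → C) (i : ι) (s : S) :
    rightComb S x (Finsupp.single i s) = MulOpposite.op s • x i := by
  simp [rightComb]

lemma rightComb_surjective {ι : Type*} {x : ι → C}
    (hx : Submodule.span Sᵐᵒᵖ (Set.range x) = ⊤) : Function.Surjective (rightComb S x) := by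
  intro c
  obtain ⟨a, rfl⟩ := Finsupp.mem_span_range_iff_exists_finsupp.1
    (hx ▸ Submodule.mem_top : c ∈ Submodule.span Sᵐᵒᵖ (Set.range x))
  refine ⟨a.mapRange MulOpposite.unop rfl, ?_⟩
  rw [rightComb_apply, Finsupp.sum_mapRange_index (by simp)]
  simp

lemma rightComb_mapRange_mul {ι : Type*} (x : ι → C) (κ : ι →₀ S) (s : S) :
    rightComb S x (κ.mapRange (· * s) (zero_mul s)) = MulOpposite.op s • rightComb S x κ := by
  rw [rightComb_apply, rightComb_apply, Finsupp.sum_mapRange_index (by simp), Finsupp.smul_sum]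
  simp [mul_smul]

/-- A vanishing tensor on a generating family is a combination of relations of that family. -/
theorem exists_relations_of_sum_bt_eq_zero {ι : Type*} {x : ι → C}
    (hx : Submodule.span Sᵐᵒᵖ (Set.range x) = ⊤) (p : ι →₀ P)
    (h : (p.sum fun i p => bt R S (x i) p) = 0) :
    ∃ (m : ℕ) (κ : Fin m → ι →₀ S) (q : Fin m → P),
      (∀ l, rightComb S x (κ l) = 0) ∧ p = ∑ l, colSMul S (κ l) (q l) := by
  -- Modulo the subgroup generated by `G`, the class of `κ q` depends only on the element `rightComb
  -- S x κ` of `C`. This yields a map from `C ⊗ P` to the quotient that takes the given tensor to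
  -- the class of `p`. Hence `p` lies in the subgroup.
  let G : Set (ι →₀ P) := {v | ∃ (κ : ι →₀ S) (q : P), rightComb S x κ = 0 ∧ v = colSMul S κ q}
  let W := (ι →₀ P) ⧸ AddSubgroup.closure G
  let γ : (ι →₀ S) →+ P →+ W :=
    (AddMonoidHom.compHom (QuotientAddGroup.mk' (AddSubgroup.closure G))).comp (colSMul S)
  have hγ : ∀ κ q, γ κ q = QuotientAddGroup.mk' (AddSubgroup.closure G) (colSMul S κ q) :=
    fun _ _ => rfl
  obtain ⟨B, hB⟩ := exists_addMonoidHom_factor (rightComb_surjective hx) γ (fun κ hκ => by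
    ext q
    exact (QuotientAddGroup.eq_zero_iff _).2 (AddSubgroup.subset_closure ⟨κ, q, hκ, rfl⟩))
  let Λ : BalancedTensor R S C P →+ W := btLift R B (fun c s p => by
    obtain ⟨κ, rfl⟩ := rightComb_surjective hx c
    rw [← rightComb_mapRange_mul, hB, hB, hγ, hγ]
    congr 1
    ext i
    simp [mul_smul])
  have hp : p ∈ AddSubgroup.closure G := by
    rw [← QuotientAddGroup.eq_zero_iff, ← QuotientAddGroup.mk'_apply, ← map_zero Λ, ← h,
      map_finsuppSum]
    conv_lhs => rw [← Finsupp.sum_single p, map_finsuppSum]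
    refine Finsupp.sum_congr fun i _ => ?_
    have : x i = rightComb S x (Finsupp.single i 1) := by simp
    rw [btLift_bt, this, hB, hγ]
    congr 1
    classical
    ext j
    rw [colSMul_apply, Finsupp.single_apply, Finsupp.single_apply]
    split <;> simp
  clear h
  induction hp using AddSubgroup.closure_induction with
  | mem v hv =>
    obtain ⟨κ, q, hκ, rfl⟩ := hv
    exact ⟨1, fun _ => κ, fun _ => q, fun _ => hκ, by simp⟩
  | zero => exact ⟨0, Fin.elim0, Fin.elim0, fun l => l.elim0, by simp⟩
  | add v w _ _ hv hw =>
    obtain ⟨m, κ, q, hκ, rfl⟩ := hv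
    obtain ⟨n, κ', q', hκ', rfl⟩ := hw
    refine ⟨m + n, Fin.append κ κ', Fin.append q q', fun l => ?_, by simp [Fin.sum_univ_add]⟩
    refine Fin.addCases (fun l => ?_) (fun l => ?_) l
    · simpa using hκ l
    · simpa using hκ' l
  | neg v _ hv =>
    obtain ⟨m, κ, q, hκ, rfl⟩ := hv
    exact ⟨m, κ, fun l => - q l, hκ, by simp⟩

lemma sum_colSMul_bt {ι : Type*} (x : ι → C) (κ : ι →₀ S) (q : P) :
    ((colSMul S κ q).sum fun i p => bt R S (x i) p) = bt R S (rightComb S x κ) q := by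
  rw [rightComb_apply, Finsupp.sum, Finsupp.sum, bt_sum_left]
  simp only [bt_balanced, colSMul_apply]
  refine Finset.sum_subset (fun i hi => ?_) (fun i _ hi => ?_)
  · rw [Finsupp.mem_support_iff, colSMul_apply] at hi
    exact Finsupp.mem_support_iff.2 fun h => hi (by rw [h, zero_smul])
  · rw [Finsupp.mem_support_iff, colSMul_apply, not_not] at hi
    rw [hi, bt_zero_right]

lemma exists_finsupp_bt {ι : Type*} {x : ι → C}
    (hx : Submodule.span Sᵐᵒᵖ (Set.range x) = ⊤) (t : BalancedTensor R S C P) :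
    ∃ p : ι →₀ P, t = p.sum fun i p => bt R S (x i) p := by
  induction t using bt_induction with
  | zero => exact ⟨0, by simp⟩
  | bt c p =>
    obtain ⟨κ, rfl⟩ := rightComb_surjective hx c
    exact ⟨colSMul S κ p, (sum_colSMul_bt x κ p).symm⟩
  | add t t' ht ht' =>
    obtain ⟨p, rfl⟩ := ht
    obtain ⟨p', rfl⟩ := ht'
    refine ⟨p + p', ?_⟩
    rw [Finsupp.sum_add_index' (by simp) (fun i => bt_add_right R S (x i))]

/-- The vanishing criterion for a finite generating family. -/
theorem exists_relations_of_fintype_sum_bt_eq_zero {ι : Type*} [Fintype ι] {x : ι → C}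
    (hx : Submodule.span Sᵐᵒᵖ (Set.range x) = ⊤) (p : ι → P)
    (h : ∑ i, bt R S (x i) (p i) = 0) :
    ∃ (m : ℕ) (κ : Fin m → ι → S) (q : Fin m → P),
      (∀ l, ∑ i, MulOpposite.op (κ l i) • x i = 0) ∧ ∀ i, p i = ∑ l, κ l i • q l := by
  obtain ⟨m, κ, q, hκ, hq⟩ := exists_relations_of_sum_bt_eq_zero (R := R) hx
    (Finsupp.equivFunOnFinite.symm p) (by rw [Finsupp.sum_fintype _ _ (by simp)]; simpa using h)
  refine ⟨m, fun l => κ l, q, fun l => ?_, fun i => ?_⟩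
  · rw [← hκ l, rightComb_apply, Finsupp.sum_fintype _ _ (by simp)]
  · simpa using DFunLike.congr_fun hq i

end Vanishing

/-! ### Character modules and their adjunction with the tensor product -/

section Characters

variable {S N P : Type*} [Ring S] [AddCommGroup P] [Module S P] [AddCommGroup N] [Module Sᵐᵒᵖ N]

noncomputable instance : Module Sᵐᵒᵖ (CharacterModule P) where
  smul s χ := AddMonoidHom.comp χ (DistribSMul.toAddMonoidHom P s.unop)
  one_smul χ := CharacterModule.ext _ fun p => congrArg χ (one_smul S p)
  mul_smul s t χ := CharacterModule.ext _ fun p => congrArg χ (mul_smul t.unop s.unop p)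
  smul_zero _ := rfl
  smul_add _ _ _ := rfl
  add_smul s t χ := CharacterModule.ext _ fun p =>
    (congrArg χ (add_smul s.unop t.unop p)).trans (map_add χ _ _)
  zero_smul χ := CharacterModule.ext _ fun p => (congrArg χ (zero_smul S p)).trans (map_zero χ)

noncomputable instance : Module S (CharacterModule N) where
  smul s χ := AddMonoidHom.comp χ (DistribSMul.toAddMonoidHom N (MulOpposite.op s))
  one_smul χ := CharacterModule.ext _ fun p => congrArg χ (one_smul Sᵐᵒᵖ p)
  mul_smul s t χ := CharacterModule.ext _ fun p =>
    congrArg χ (mul_smul (MulOpposite.op t) (MulOpposite.op s) p)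
  smul_zero _ := rfl
  smul_add _ _ _ := rfl
  add_smul s t χ := CharacterModule.ext _ fun p =>
    (congrArg χ (add_smul (MulOpposite.op s) (MulOpposite.op t) p)).trans (map_add χ _ _)
  zero_smul χ := CharacterModule.ext _ fun p => (congrArg χ (zero_smul Sᵐᵒᵖ p)).trans (map_zero χ)

@[simp] lemma op_smul_char_apply (s : Sᵐᵒᵖ) (χ : CharacterModule P) (p : P) :
    (s • χ) p = χ (s.unop • p) := rfl

@[simp] lemma smul_char_apply (s : S) (χ : CharacterModule N) (n : N) :
    (s • χ) n = χ (MulOpposite.op s • n) := rfl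

@[simp] lemma char_add_apply {A : Type*} [AddCommGroup A] (χ ψ : CharacterModule A) (a : A) :
    (χ + ψ) a = χ a + ψ a := rfl

@[simp] lemma char_sub_apply {A : Type*} [AddCommGroup A] (χ ψ : CharacterModule A) (a : A) :
    (χ - ψ) a = χ a - ψ a := rfl

@[simp] lemma char_zero_apply {A : Type*} [AddCommGroup A] (a : A) :
    (0 : CharacterModule A) a = 0 := rfl

lemma char_sum_apply {A ι : Type*} [AddCommGroup A] (s : Finset ι) (χ : ι → CharacterModule A)
    (a : A) : (∑ i ∈ s, χ i) a = ∑ i ∈ s, χ i a := by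
  classical
  induction s using Finset.induction_on with
  | empty => rfl
  | insert i s hi ih => rw [Finset.sum_insert hi, Finset.sum_insert hi, char_add_apply, ih]

/-- A character that vanishes on the kernel of `f` factors through `f`. -/
lemma exists_char_factor {A B : Type*} [AddCommGroup A] [AddCommGroup B] (f : A →+ B)
    (χ : CharacterModule A) (h : ∀ a, f a = 0 → χ a = 0) :
    ∃ ψ : CharacterModule B, ∀ a, ψ (f a) = χ a := by
  -- Descend to the image of `f`, then extend to `B` by the divisibility of ℚ/ℤ.
  obtain ⟨k, hk⟩ := exists_addMonoidHom_factor f.rangeRestrict_surjective χ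
    (fun a ha => h a (congrArg Subtype.val ha))
  obtain ⟨ψ, hψ⟩ := CharacterModule.dual_surjective_of_injective
    (f.range.subtype.toIntLinearMap) Subtype.val_injective k
  exact ⟨ψ, fun a => (DFunLike.congr_fun hψ (f.rangeRestrict a)).trans (hk a)⟩

lemma eq_zero_of_forall_char {A : Type*} [AddCommGroup A] {a : A}
    (h : ∀ χ : CharacterModule A, χ a = 0) : a = 0 :=
  CharacterModule.eq_zero_of_character_apply h

variable (R : Type*) [Ring R] [Module R N] [SMulCommClass R Sᵐᵒᵖ N]

/-- The character of `N ⊗_S P` attached to a map from `N` to the character module of `P`. -/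
noncomputable def btChar (h : N →ₗ[Sᵐᵒᵖ] CharacterModule P) :
    CharacterModule (BalancedTensor R S N P) :=
  btLift R (AddMonoidHom.mk' (fun n => (h n : P →+ AddCircle (1 : ℚ))) fun n n' => map_add h n n')
    (fun n s p => DFunLike.congr_fun (map_smul h (MulOpposite.op s) n) p)

@[simp] lemma btChar_bt (h : N →ₗ[Sᵐᵒᵖ] CharacterModule P) (n : N) (p : P) :
    btChar R h (bt R S n p) = h n p :=
  btLift_bt _ _ n p

variable {R}

/-- The map from `N` to the character module of `P` attached to a character of `N ⊗_S P`. -/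
noncomputable def btCharCurry (χ : CharacterModule (BalancedTensor R S N P)) :
    N →ₗ[Sᵐᵒᵖ] CharacterModule P where
  toFun n := AddMonoidHom.comp χ (btHom R S n)
  map_add' n n' := CharacterModule.ext _ fun p =>
    (congrArg χ (bt_add_left R S n n' p)).trans (map_add χ _ _)
  map_smul' s n := CharacterModule.ext _ fun p => congrArg χ (bt_balanced R S n s.unop p)

@[simp] lemma btCharCurry_apply (χ : CharacterModule (BalancedTensor R S N P)) (n : N) (p : P) :
    btCharCurry χ n p = χ (bt R S n p) := rfl

lemma btChar_btCharCurry (χ : CharacterModule (BalancedTensor R S N P)) :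
    btChar R (btCharCurry χ) = χ :=
  bt_hom_ext (f := btChar R (btCharCurry χ)) (g := χ) fun n p => btChar_bt R (btCharCurry χ) n p

/-- The map `ψ ↦ ψ ∘ g` on character modules. -/
noncomputable def charMap {P' : Type*} [AddCommGroup P'] [Module S P'] (g : P →ₗ[S] P') :
    CharacterModule P' →ₗ[Sᵐᵒᵖ] CharacterModule P where
  toFun ψ := AddMonoidHom.comp ψ g.toAddMonoidHom
  map_add' _ _ := rfl
  map_smul' s ψ := CharacterModule.ext _ fun p => congrArg ψ (map_smul g s.unop p).symm

@[simp] lemma charMap_apply {P' : Type*} [AddCommGroup P'] [Module S P'] (g : P →ₗ[S] P')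
    (ψ : CharacterModule P') (p : P) : charMap g ψ p = ψ (g p) := rfl

end Characters

/-! ### Direct summands of injective modules -/

section Retracts

variable {T : Type u} [Ring T] {A B : Type u} [AddCommGroup A] [AddCommGroup B] [Module T A]
  [Module T B]

lemma injective_of_retract (hB : Module.Injective T B) (j : A →ₗ[T] B) (r : B →ₗ[T] A)
    (h : ∀ a, r (j a) = a) : Module.Injective T A where
  out X Y _ _ _ _ f hf g := by
    obtain ⟨k, hk⟩ := hB.out f hf (j ∘ₗ g)
    exact ⟨r ∘ₗ k, fun x => by simp [hk, h]⟩

lemma injective_of_projector (hB : Module.Injective T B) (j : A →ₗ[T] B)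
    (hj : Function.Injective j) (e : B →ₗ[T] B) (he : ∀ b, e b ∈ LinearMap.range j)
    (h : ∀ a, e (j a) = j a) : Module.Injective T A :=
  injective_of_retract hB j ((LinearEquiv.ofInjective j hj).symm ∘ₗ e.codRestrict _ he) fun a => by
    apply hj
    simp [h]

end Retracts

/-! ### Flatness: the character criterion, the equational criterion, exact sequences, double duals
-/

section Flat

variable {S : Type u} [Ring S] {P : Type u} [AddCommGroup P] [Module S P]

/-- A module is flat if and only if its character module is injective. -/
theorem isFlat_iff_injective : IsFlat S P ↔ Module.Injective Sᵐᵒᵖ (CharacterModule P) := by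
  constructor
  · refine fun hP => ⟨fun X Y _ _ _ _ f hf g => ?_⟩
    -- Maps `X → P⁺` are characters of `X ⊗ P`, and these extend along the injection `f ⊗ P`.
    obtain ⟨ψ, hψ⟩ := CharacterModule.dual_surjective_of_injective _ (hP X Y f hf) (btChar ℤ g)
    refine ⟨btCharCurry ψ, fun x => CharacterModule.ext _ fun p => ?_⟩
    have := DFunLike.congr_fun hψ (bt ℤ S x p)
    rw [btChar_bt] at this
    rw [← this, btCharCurry_apply, ← balancedTensorMap_bt]
    rfl
  · intro hP N N' _ _ _ _ f hf
    rw [injective_iff_map_eq_zero]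
    refine fun t ht => eq_zero_of_forall_char fun χ => ?_
    obtain ⟨h, hh⟩ := hP.out f hf (btCharCurry χ)
    have : ∀ t, btChar ℤ h (balancedTensorMap f P t) = χ t := by
      intro t
      induction t using bt_induction with
      | zero => simp
      | bt n p => rw [balancedTensorMap_bt, btChar_bt, hh, btCharCurry_apply]
      | add x y hx hy => rw [map_add, map_add, map_add, hx, hy]
    rw [← this, ht, map_zero]

lemma span_range_subtype_eq_top {C ι : Type*} [AddCommGroup C] [Module Sᵐᵒᵖ C] (x : ι → C) :
    Submodule.span Sᵐᵒᵖ (Set.range fun i =>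
      (⟨x i, Submodule.subset_span ⟨i, rfl⟩⟩ : Submodule.span Sᵐᵒᵖ (Set.range x))) = ⊤ := by
  apply Submodule.map_injective_of_injective (Submodule.injective_subtype _)
  rw [Submodule.map_span, ← Set.range_comp, Submodule.map_top, Submodule.range_subtype]
  rfl

/-- The equational criterion: vanishing tensors with a flat module are explained by relations. -/
theorem IsFlat.exists_relations (hP : IsFlat S P) {R ι : Type*} {M : Type u} [Ring R]
    [AddCommGroup M] [Module R M] [Module Sᵐᵒᵖ M] [SMulCommClass R Sᵐᵒᵖ M] [Fintype ι]
    (n : ι → M) (p : ι → P) (h : ∑ i, bt R S (n i) (p i) = 0) :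
    ∃ (m : ℕ) (κ : Fin m → ι → S) (q : Fin m → P),
      (∀ l, ∑ i, MulOpposite.op (κ l i) • n i = 0) ∧ ∀ i, p i = ∑ l, κ l i • q l := by
  let M₀ := Submodule.span Sᵐᵒᵖ (Set.range n)
  let x : ι → M₀ := fun i => ⟨n i, Submodule.subset_span ⟨i, rfl⟩⟩
  have hx : Submodule.span Sᵐᵒᵖ (Set.range x) = ⊤ := span_range_subtype_eq_top n
  have h0 : ∑ i, bt ℤ S (x i) (p i) = 0 := by
    -- Flatness pulls the vanishing back to the submodule generated by the `n i`, where the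
    -- criterion for generating families applies.
    apply hP M₀ M M₀.subtype M₀.injective_subtype
    rw [map_zero, map_sum]
    have := congrArg (btForget R S) h
    rw [map_zero, map_sum] at this
    simpa using this
  obtain ⟨m, κ, q, hκ, hq⟩ := exists_relations_of_fintype_sum_bt_eq_zero hx p h0
  exact ⟨m, κ, q, fun l => by simpa [x] using congrArg Subtype.val (hκ l), hq⟩

lemma IsFlat.exists_relations_smul (hP : IsFlat S P) {ι : Type*} [Fintype ι] (s : ι → S)
    (p : ι → P) (h : ∑ i, s i • p i = 0) :
    ∃ (m : ℕ) (κ : Fin m → ι → S) (q : Fin m → P),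
      (∀ l, ∑ i, s i * κ l i = 0) ∧ ∀ i, p i = ∑ l, κ l i • q l := by
  have h0 : ∑ i, bt ℤ S (s i) (p i) = 0 := by
    have : ∀ i, bt ℤ S (s i) (p i) = bt ℤ S 1 (s i • p i) := fun i => by
      rw [← bt_balanced]; simp
    simp only [this]
    rw [← bt_sum_right, h, bt_zero_right]
  exact hP.exists_relations (M := S) s p h0

/-- The equational criterion for flatness. -/
theorem isFlat_of_exists_relations
    (h : ∀ (n : ℕ) (s : Fin n → S) (p : Fin n → P), ∑ i, s i • p i = 0 →
      ∃ (m : ℕ) (κ : Fin m → Fin n → S) (q : Fin m → P),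
        (∀ l, ∑ i, s i * κ l i = 0) ∧ ∀ i, p i = ∑ l, κ l i • q l) : IsFlat S P := by
  rw [isFlat_iff_injective]
  refine Module.Baer.injective fun I g => ?_
  -- The hypothesis amounts to injectivity of the multiplication `I ⊗ P → P`. The character attached
  -- to `g` therefore factors through it, and the factor `φ` is the element of `P⁺` required by
  -- Baer's criterion.
  let μ : BalancedTensor ℤ S I P →+ P := btLift ℤ
    (AddMonoidHom.mk' (fun x => smulAddHom S P (x : Sᵐᵒᵖ).unop) fun x y => by simp)
    (fun x s p => by simp [mul_smul])
  have hμ : ∀ x p, μ (bt ℤ S x p) = (x : Sᵐᵒᵖ).unop • p := fun x p => btLift_bt _ _ _ _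
  obtain ⟨φ, hφ⟩ := exists_char_factor μ (btChar ℤ g) (fun t ht => by
    obtain ⟨n, x, p, rfl⟩ := exists_sum_bt ℤ S t
    simp only [map_sum, hμ] at ht
    obtain ⟨m, κ, q, hκ, hq⟩ := h n _ p ht
    simp only [hq, bt_sum_right, ← bt_balanced]
    rw [Finset.sum_comm]
    have hx : ∀ l, ∑ i, MulOpposite.op (κ l i) • x i = 0 := fun l => by
      apply Subtype.ext
      have := congrArg MulOpposite.op (hκ l)
      simpa using this
    simp only [← bt_sum_left, hx, bt_zero_left, Finset.sum_const_zero, map_zero])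
  refine ⟨LinearMap.toSpanSingleton Sᵐᵒᵖ _ φ, fun x hx => CharacterModule.ext _ fun p => ?_⟩
  rw [LinearMap.toSpanSingleton_apply, op_smul_char_apply, ← btChar_bt ℤ g, ← hφ, hμ]

lemma isFlat_finsupp (ι : Type u) : IsFlat S (ι →₀ S) := by
  classical
  refine isFlat_of_exists_relations fun n s p hp => ?_
  let J := Finset.univ.biUnion fun k => (p k).support
  let e := J.equivFin
  -- Each coordinate of the `p k` is itself a relation among the `s k`. The `q l` are the basis
  -- vectors on the union of the supports.
  refine ⟨J.card, fun l k => p k (e.symm l), fun l => Finsupp.single (e.symm l) 1,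
    fun l => ?_, fun k => ?_⟩
  · simpa [Finsupp.finsetSum_apply] using DFunLike.congr_fun hp (e.symm l : ι)
  · have h1 : p k = ∑ j ∈ J, Finsupp.single j (p k j) := by
      conv_lhs => rw [← Finsupp.sum_single (p k)]
      exact Finsupp.sum_of_support_subset _
        (Finset.subset_biUnion_of_mem (fun k => (p k).support) (Finset.mem_univ k)) _ (by simp)
    conv_lhs => rw [h1, ← Finset.sum_coe_sort, ← e.symm.sum_comp]
    simp

section ShortExact

variable {K F Q : Type u} [AddCommGroup K] [Module S K] [AddCommGroup F] [Module S F]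
  [AddCommGroup Q] [Module S Q] {i : K →ₗ[S] F} {g : F →ₗ[S] Q}

lemma charMap_surjective (hi : Function.Injective i) : Function.Surjective (charMap i) :=
  fun χ => by
    obtain ⟨ψ, hψ⟩ := exists_char_factor i.toAddMonoidHom χ (fun k hk => by
      rw [hi (hk.trans (map_zero i).symm), map_zero])
    exact ⟨ψ, CharacterModule.ext _ hψ⟩

lemma exists_charMap_eq (hex : Function.Exact i g)
    {φ : CharacterModule F} (hφ : charMap i φ = 0) : ∃ ψ, charMap g ψ = φ := by
  obtain ⟨ψ, hψ⟩ := exists_char_factor g.toAddMonoidHom φ (fun f hf => by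
    obtain ⟨k, rfl⟩ := (hex f).1 hf
    exact DFunLike.congr_fun hφ k)
  exact ⟨ψ, CharacterModule.ext _ hψ⟩

lemma charMap_injective (hg : Function.Surjective g) : Function.Injective (charMap g) :=
  fun χ ψ h => CharacterModule.ext _ fun q => by
    obtain ⟨f, rfl⟩ := hg q
    exact DFunLike.congr_fun h f

/-- The character dual of a short exact sequence with flat cokernel splits. -/
lemma IsFlat.exists_charMap_section (hQ : IsFlat S Q) (hi : Function.Injective i)
    (hg : Function.Surjective g) (hex : Function.Exact i g) :
    ∃ σ : CharacterModule K →ₗ[Sᵐᵒᵖ] CharacterModule F, ∀ χ, charMap i (σ χ) = χ := by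
  rw [isFlat_iff_injective] at hQ
  obtain ⟨r, hr⟩ := hQ.out (charMap g) (charMap_injective hg) LinearMap.id
  -- The retraction `r` onto `Q⁺` exists because `Q⁺` is injective. The complementary projector `T`
  -- kills `Q⁺`, the kernel of `charMap i`, so it descends to a section on `K⁺`.
  let T : CharacterModule F →ₗ[Sᵐᵒᵖ] CharacterModule F := LinearMap.id - charMap g ∘ₗ r
  have hT : LinearMap.ker (charMap i) ≤ LinearMap.ker T := by
    intro φ hφ
    obtain ⟨ψ, rfl⟩ := exists_charMap_eq hex hφ
    simp [T, hr]
  have hgi : ∀ ψ, charMap i (charMap g ψ) = 0 := fun ψ => CharacterModule.ext _ fun k => by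
    simp [hex.apply_apply_eq_zero]
  refine ⟨(LinearMap.ker (charMap i)).liftQ T hT ∘ₗ
    ((charMap i).quotKerEquivOfSurjective (charMap_surjective hi)).symm.toLinearMap, fun χ => ?_⟩
  obtain ⟨φ, rfl⟩ := charMap_surjective hi χ
  have : ((charMap i).quotKerEquivOfSurjective (charMap_surjective hi)).symm (charMap i φ) =
      Submodule.Quotient.mk φ := by
    rw [LinearEquiv.symm_apply_eq]
    rfl
  simp [this, T, hgi]

/-- A character of `C ⊗ K` is a map `C → K⁺`. Composing with the section `K⁺ → F⁺` extends it to `C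
⊗ F`, so characters detect that nothing is lost. Only the cokernel has to be flat. -/
lemma IsFlat.btMap_injective {R C : Type*} [Ring R] [AddCommGroup C] [Module R C] [Module Sᵐᵒᵖ C]
    [SMulCommClass R Sᵐᵒᵖ C] (hQ : IsFlat S Q) (hi : Function.Injective i)
    (hg : Function.Surjective g) (hex : Function.Exact i g) :
    Function.Injective (btMap R C i) := by
  obtain ⟨σ, hσ⟩ := hQ.exists_charMap_section hi hg hex
  rw [injective_iff_map_eq_zero]
  refine fun t ht => eq_zero_of_forall_char fun χ => ?_
  have : ∀ t, btChar R (σ ∘ₗ btCharCurry χ) (btMap R C i t) = χ t := by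
    intro t
    induction t using bt_induction with
    | zero => simp
    | bt n p =>
      rw [btMap_bt, btChar_bt, LinearMap.comp_apply, ← charMap_apply, hσ, btCharCurry_apply]
    | add x y hx hy => rw [map_add, map_add, map_add, hx, hy]
  rw [← this, ht, map_zero]

lemma IsFlat.kernel (hQ : IsFlat S Q) (hF : IsFlat S F) (hi : Function.Injective i)
    (hg : Function.Surjective g) (hex : Function.Exact i g) : IsFlat S K := by
  obtain ⟨σ, hσ⟩ := hQ.exists_charMap_section hi hg hex
  rw [isFlat_iff_injective] at hF ⊢
  exact injective_of_retract hF σ (charMap i) hσ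

end ShortExact

section DoubleDual

variable (S P) in
/-- The evaluation map from a module to its double character dual. -/
noncomputable def doubleDualEval : P →ₗ[S] CharacterModule (CharacterModule P) where
  toFun p := AddMonoidHom.mk' (fun χ : CharacterModule P => χ p) fun _ _ => rfl
  map_add' p q := CharacterModule.ext _ fun χ => map_add χ p q
  map_smul' _ _ := rfl

@[simp] lemma doubleDualEval_apply (p : P) (χ : CharacterModule P) :
    doubleDualEval S P p χ = χ p := rfl

lemma doubleDualEval_injective : Function.Injective (doubleDualEval S P) := by
  rw [injective_iff_map_eq_zero]
  exact fun p hp => eq_zero_of_forall_char fun χ => DFunLike.congr_fun hp χ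

/-- The evaluation map for a right module. -/
noncomputable def doubleDualEvalOp (N : Type*) [AddCommGroup N] [Module Sᵐᵒᵖ N] :
    N →ₗ[Sᵐᵒᵖ] CharacterModule (CharacterModule N) where
  toFun p := AddMonoidHom.mk' (fun χ : CharacterModule N => χ p) fun _ _ => rfl
  map_add' p q := CharacterModule.ext _ fun χ => map_add χ p q
  map_smul' _ _ := rfl

@[simp] lemma doubleDualEvalOp_apply {N : Type*} [AddCommGroup N] [Module Sᵐᵒᵖ N] (n : N)
    (χ : CharacterModule N) : doubleDualEvalOp (S := S) N n χ = χ n := rfl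

/-- Restriction `P⁺⁺⁺ → P⁺` along evaluation is split by the evaluation of `P⁺`. Its kernel, the
dual of the quotient, is thus a direct summand of the injective module `P⁺⁺⁺`. -/
lemma isFlat_doubleDual_quotient (h : IsFlat S (CharacterModule (CharacterModule P))) :
    IsFlat S (CharacterModule (CharacterModule P) ⧸ LinearMap.range (doubleDualEval S P)) := by
  rw [isFlat_iff_injective] at h ⊢
  have hs := Submodule.mkQ_surjective (LinearMap.range (doubleDualEval S P))
  have hex : Function.Exact (doubleDualEval S P) (LinearMap.range (doubleDualEval S P)).mkQ :=
    LinearMap.exact_map_mkQ_range _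
  refine injective_of_projector h (charMap (LinearMap.range (doubleDualEval S P)).mkQ)
    (charMap_injective hs)
    (LinearMap.id - doubleDualEvalOp (S := S) (CharacterModule P) ∘ₗ charMap (doubleDualEval S P))
    (fun ψ => ?_) (fun ψ => ?_)
  · apply exists_charMap_eq hex
    exact CharacterModule.ext _ fun p => by simp
  · have : charMap (doubleDualEval S P) (charMap (LinearMap.range (doubleDualEval S P)).mkQ ψ) = 0 :=
      CharacterModule.ext _ fun p => by
        rw [charMap_apply, charMap_apply, hex.apply_apply_eq_zero, map_zero, char_zero_apply]
    simp [this]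

end DoubleDual

end Flat

/-! ### Finite presentation and coherence: flat products and flat character modules -/

section Coherent

variable {S : Type u} [Ring S]

lemma exists_linearMap_factor {T A B X : Type*} [Ring T] [AddCommGroup A] [AddCommGroup B]
    [AddCommGroup X] [Module T A] [Module T B] [Module T X] {f : A →ₗ[T] B}
    (hf : Function.Surjective f) (g : A →ₗ[T] X) (h : ∀ a, f a = 0 → g a = 0) :
    ∃ k : B →ₗ[T] X, ∀ a, k (f a) = g a := by
  refine ⟨(LinearMap.ker f).liftQ g (fun a ha => h a ha) ∘ₗ
    (f.quotKerEquivOfSurjective hf).symm.toLinearMap, fun a => ?_⟩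
  have : (f.quotKerEquivOfSurjective hf).symm (f a) = Submodule.Quotient.mk a := by
    rw [LinearEquiv.symm_apply_eq]
    rfl
  rw [LinearMap.comp_apply, LinearEquiv.coe_coe, this]
  exact Submodule.liftQ_apply _ _ _

section

variable {C N : Type*} [AddCommGroup C] [Module Sᵐᵒᵖ C] [AddCommGroup N] [Module Sᵐᵒᵖ N]

lemma fintype_linearCombination_op_surjective {ι : Type*} [Fintype ι] {x : ι → C}
    (hx : Submodule.span Sᵐᵒᵖ (Set.range x) = ⊤) :
    Function.Surjective (Fintype.linearCombination Sᵐᵒᵖ x) := by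
  rw [← LinearMap.range_eq_top, Fintype.range_linearCombination, hx]

/-- A finite generating family of a finitely presented right module has finitely generated
relations. -/
lemma exists_finite_relations [Module.FinitePresentation Sᵐᵒᵖ C] {ι : Type*} [Fintype ι]
    {x : ι → C} (hx : Submodule.span Sᵐᵒᵖ (Set.range x) = ⊤) :
    ∃ (m : ℕ) (κ : Fin m → ι → S), (∀ l, ∑ i, MulOpposite.op (κ l i) • x i = 0) ∧
      ∀ v : ι → S, ∑ i, MulOpposite.op (v i) • x i = 0 →
        ∃ c : Fin m → S, ∀ i, v i = ∑ l, κ l i * c l := by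
  have hfg := Module.FinitePresentation.fg_ker _ (fintype_linearCombination_op_surjective hx)
  obtain ⟨m, a, ha⟩ := Submodule.fg_iff_exists_fin_generating_family.1 hfg
  refine ⟨m, fun l i => (a l i).unop, fun l => ?_, fun v hv => ?_⟩
  · have : a l ∈ LinearMap.ker (Fintype.linearCombination Sᵐᵒᵖ x) :=
      ha ▸ Submodule.subset_span ⟨l, rfl⟩
    simpa [Fintype.linearCombination_apply] using this
  · have : (fun i => MulOpposite.op (v i)) ∈ Submodule.span Sᵐᵒᵖ (Set.range a) := by
      rw [ha]
      simpa [Fintype.linearCombination_apply] using hv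
    obtain ⟨c, hc⟩ := (Submodule.mem_span_range_iff_exists_fun _).1 this
    refine ⟨fun l => (c l).unop, fun i => ?_⟩
    have := congrArg MulOpposite.unop (congrFun hc i)
    simpa using this.symm

/-- Characters of `N` that annihilate all homomorphisms from a finitely presented module are
combinations of its relations. -/
lemma exists_relations_of_forall_hom [Module.FinitePresentation Sᵐᵒᵖ C] {ι : Type*} [Fintype ι]
    {x : ι → C} (hx : Submodule.span Sᵐᵒᵖ (Set.range x) = ⊤) (φ : ι → CharacterModule N)
    (h : ∀ f : C →ₗ[Sᵐᵒᵖ] N, ∑ i, φ i (f (x i)) = 0) :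
    ∃ (m : ℕ) (κ : Fin m → ι → S) (q : Fin m → CharacterModule N),
      (∀ l, ∑ i, MulOpposite.op (κ l i) • x i = 0) ∧ ∀ i, φ i = ∑ l, κ l i • q l := by
  classical
  obtain ⟨m, κ, hκ, hκ'⟩ := exists_finite_relations hx
  let Φ : (ι → N) →+ AddCircle (1 : ℚ) :=
    AddMonoidHom.mk' (fun e => ∑ i, φ i (e i)) fun e e' => by simp [Finset.sum_add_distrib]
  let ν : (ι → N) →+ (Fin m → N) :=
    AddMonoidHom.mk' (fun e l => ∑ i, MulOpposite.op (κ l i) • e i) fun e e' => by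
      ext l; simp [Finset.sum_add_distrib]
  -- The kernel of `ν` consists of the families `e` that satisfy the relations of `C`, that is, of
  -- the values on `x` of maps `C → N`. Hence `Φ` vanishes there and factors through `ν`. The
  -- components of the factor `ψ` are the `q l`.
  obtain ⟨ψ, hψ⟩ := exists_char_factor ν Φ (fun e he => by
    obtain ⟨f, hf⟩ := exists_linearMap_factor (fintype_linearCombination_op_surjective hx)
      (Fintype.linearCombination Sᵐᵒᵖ e) (fun v hv => by
        rw [Fintype.linearCombination_apply] at hv ⊢
        obtain ⟨c, hc⟩ := hκ' (fun i => (v i).unop) hv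
        have hc' : ∀ i, v i = ∑ l, MulOpposite.op (c l) * MulOpposite.op (κ l i) := fun i => by
          rw [← MulOpposite.op_unop (v i), hc, Finset.op_sum]
          simp
        simp only [hc', Finset.sum_smul, mul_smul]
        rw [Finset.sum_comm]
        simp only [← Finset.smul_sum]
        exact Finset.sum_eq_zero fun l _ => by
          rw [show ∑ i, MulOpposite.op (κ l i) • e i = 0 from congrFun he l, smul_zero])
    have hf' : ∀ i, f (x i) = e i := fun i => by
      have := hf (Pi.single i 1)
      simpa [Fintype.linearCombination_apply_single] using this
    exact (Finset.sum_congr rfl fun i _ => by rw [hf']).trans (h f))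
  refine ⟨m, κ, fun l => AddMonoidHom.comp ψ (AddMonoidHom.single (fun _ : Fin m => N) l), hκ,
    fun i => CharacterModule.ext _ fun n => ?_⟩
  rw [char_sum_apply]
  have h1 : Φ (Pi.single i n) = φ i n := by
    change ∑ j, φ j (Pi.single (M := fun _ => N) i n j) = _
    rw [Finset.sum_eq_single i] <;> simp +contextual
  have h2 : ν (Pi.single i n) = ∑ l, Pi.single l (MulOpposite.op (κ l i) • n) := by
    rw [Finset.univ_sum_single]
    ext l
    change ∑ j, MulOpposite.op (κ l j) • (Pi.single (M := fun _ => N) i n j) = _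
    rw [Finset.sum_eq_single i] <;> simp +contextual
  have h3 := hψ (Pi.single i n)
  rw [h2, map_sum] at h3
  exact h1.symm.trans h3.symm

end

lemma IsRightCoherent.finitePresentation_span (hS : IsRightCoherent S) {n : ℕ} (s : Fin n → S) :
    Module.FinitePresentation Sᵐᵒᵖ (Submodule.span Sᵐᵒᵖ (Set.range s)) :=
  hS _ (Submodule.fg_span (Set.finite_range s))

/-- Over a right coherent ring, products of flat left modules are flat. -/
theorem IsRightCoherent.isFlat_pi (hS : IsRightCoherent S) {J : Type u} {P : J → Type u}
    [∀ j, AddCommGroup (P j)] [∀ j, Module S (P j)] (hP : ∀ j, IsFlat S (P j)) :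
    IsFlat S (∀ j, P j) := by
  refine isFlat_of_exists_relations fun n s p hp => ?_
  have := hS.finitePresentation_span s
  -- Coherence gives one finite generating set of relations that serves every index `j`, so the
  -- solutions in the factors assemble to solutions in the product.
  obtain ⟨m, κ, hκ, hκ'⟩ := exists_finite_relations (span_range_subtype_eq_top (S := S) s)
  have key : ∀ j, ∃ q : Fin m → P j, ∀ i, p i j = ∑ l, κ l i • q l := by
    intro j
    obtain ⟨a, v, q, hv, hq⟩ := (hP j).exists_relations_smul s (fun i => p i j)
      (by simpa using congrFun hp j)
    choose c hc using fun b => hκ' (v b) (Subtype.ext (by simpa using hv b))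
    refine ⟨fun l => ∑ b, c b l • q b, fun i => ?_⟩
    simp only [hq, hc, Finset.sum_smul, Finset.smul_sum, mul_smul]
    rw [Finset.sum_comm]
  choose q hq using key
  refine ⟨m, κ, fun l j => q j l, fun l => by simpa using congrArg Subtype.val (hκ l),
    fun i => ?_⟩
  ext j
  simp [hq]

/-- Over a right coherent ring, character modules of injective right modules are flat. -/
theorem IsRightCoherent.isFlat_characterModule (hS : IsRightCoherent S) {E : Type u}
    [AddCommGroup E] [Module Sᵐᵒᵖ E] (hE : Module.Injective Sᵐᵒᵖ E) :
    IsFlat S (CharacterModule E) := by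
  refine isFlat_of_exists_relations fun n s φ hφ => ?_
  have := hS.finitePresentation_span s
  obtain ⟨m, κ, q, hκ, hq⟩ := exists_relations_of_forall_hom (span_range_subtype_eq_top (S := S) s) φ
    (fun f => by
      -- A map from the ideal to the injective `E` extends to `S`, so it is given by the element `g
      -- 1`. The sum to be killed is then `∑ s i • φ i` evaluated at `g 1`.
      obtain ⟨g, hg⟩ := Module.Baer.extension_property
        (Module.Baer.of_injective hE) (Submodule.subtype _) (Submodule.injective_subtype _) f
      have : ∀ i, f ⟨s i, Submodule.subset_span ⟨i, rfl⟩⟩ = MulOpposite.op (s i) • g 1 := by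
        intro i
        rw [← hg, ← map_smul]
        simp
      simp only [this, ← smul_char_apply, ← char_sum_apply, hφ, char_zero_apply])
  exact ⟨m, κ, q, fun l => by simpa using congrArg Subtype.val (hκ l), hq⟩

lemma IsRightCoherent.isFlat_doubleDual (hS : IsRightCoherent S) {P : Type u} [AddCommGroup P]
    [Module S P] (hP : IsFlat S P) : IsFlat S (CharacterModule (CharacterModule P)) :=
  hS.isFlat_characterModule (isFlat_iff_injective.1 hP)

end Coherent

/-! ### Finitely presented `C`: products, double duals, factorization through powers of `C` -/

section FinitePresentation

variable {R S C : Type u} [Ring R] [Ring S] [AddCommGroup C] [Module R C]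
  [Module Sᵐᵒᵖ C] [SMulCommClass R Sᵐᵒᵖ C]

lemma exists_fin_bt {n : ℕ} {x : Fin n → C} (hx : Submodule.span Sᵐᵒᵖ (Set.range x) = ⊤)
    {P : Type*} [AddCommGroup P] [Module S P] (t : BalancedTensor R S C P) :
    ∃ p : Fin n → P, t = ∑ i, bt R S (x i) (p i) := by
  obtain ⟨p, rfl⟩ := exists_finsupp_bt hx t
  exact ⟨p, Finsupp.sum_fintype _ _ (by simp)⟩

lemma exists_fin_span_eq_top (S C : Type*) [Ring S] [AddCommGroup C] [Module Sᵐᵒᵖ C]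
    [Module.Finite Sᵐᵒᵖ C] :
    ∃ (n : ℕ) (x : Fin n → C), Submodule.span Sᵐᵒᵖ (Set.range x) = ⊤ :=
  Module.Finite.exists_fin

lemma sum_bt_relations {ι : Type*} [Fintype ι] {m : ℕ} {x : ι → C} {κ : Fin m → ι → S}
    (hκ : ∀ l, ∑ i, MulOpposite.op (κ l i) • x i = 0) {P : Type*} [AddCommGroup P] [Module S P]
    (q : Fin m → P) : ∑ i, bt R S (x i) (∑ l, κ l i • q l) = 0 := by
  simp only [bt_sum_right, ← bt_balanced]
  rw [Finset.sum_comm]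
  simp only [← bt_sum_left, hκ, bt_zero_left, Finset.sum_const_zero]

variable (R S C) in
/-- The comparison map from `C ⊗ ∏ P j` to `∏ C ⊗ P j`. -/
noncomputable def btPi {J : Type*} (P : J → Type*) [∀ j, AddCommGroup (P j)] [∀ j, Module S (P j)] :
    BalancedTensor R S C (∀ j, P j) →ₗ[R] (∀ j, BalancedTensor R S C (P j)) :=
  LinearMap.pi fun j => btMap R C (LinearMap.proj j)

/-- Tensoring with a finitely presented module commutes with products. -/
theorem btPi_bijective [Module.FinitePresentation Sᵐᵒᵖ C] {J : Type*} (P : J → Type*)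
    [∀ j, AddCommGroup (P j)] [∀ j, Module S (P j)] : Function.Bijective (btPi R S C P) := by
  obtain ⟨n, x, hx⟩ := exists_fin_span_eq_top S C
  constructor
  · rw [injective_iff_map_eq_zero]
    intro t ht
    obtain ⟨p, rfl⟩ := exists_fin_bt hx t
    obtain ⟨m, κ, hκ, hκ'⟩ := exists_finite_relations hx
    have key : ∀ j, ∃ q : Fin m → P j, ∀ i, p i j = ∑ l, κ l i • q l := by
      intro j
      have hj := congrFun ht j
      simp only [btPi, LinearMap.pi_apply, map_sum, btMap_bt] at hj
      obtain ⟨a, v, q, hv, hq⟩ := exists_relations_of_fintype_sum_bt_eq_zero hx _ hj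
      choose c hc using fun b => hκ' (v b) (hv b)
      refine ⟨fun l => ∑ b, c b l • q b, fun i => ?_⟩
      refine (hq i).trans ?_
      simp only [hc, Finset.sum_smul, Finset.smul_sum, mul_smul]
      rw [Finset.sum_comm]
    choose q hq using key
    have : p = fun i => ∑ l, κ l i • (fun l j => q j l) l := by
      ext i j
      simp [hq]
    rw [this]
    exact sum_bt_relations hκ _
  · intro t
    choose p hp using fun j => exists_fin_bt hx (t j)
    refine ⟨∑ i, bt R S (x i) (fun j => p j i), ?_⟩
    ext j
    simp [btPi, hp]

variable (R S C) in
/-- The comparison map from `C ⊗ P⁺⁺` to `(C ⊗ P)⁺⁺`. -/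
noncomputable def btDoubleDual (P : Type*) [AddCommGroup P] [Module S P] :
    BalancedTensor R S C (CharacterModule (CharacterModule P)) →ₗ[R]
      CharacterModule (CharacterModule (BalancedTensor R S C P)) :=
  btLiftₗ R (AddMonoidHom.mk' (fun c => AddMonoidHom.mk'
      (fun φ => (AddMonoidHom.mk' (fun χ : CharacterModule (BalancedTensor R S C P) =>
        φ (btCharCurry χ c)) fun χ χ' => map_add φ (btCharCurry χ c) (btCharCurry χ' c) :
          CharacterModule (CharacterModule (BalancedTensor R S C P))))
      fun φ φ' => rfl)
      fun c c' => by
        ext φ χ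
        exact (congrArg φ (map_add (btCharCurry χ) c c')).trans (map_add φ _ _))
    (fun c s φ => CharacterModule.ext _ fun χ =>
      congrArg φ (map_smul (btCharCurry χ) (MulOpposite.op s) c))
    (fun r c φ => rfl)

lemma btDoubleDual_bt {P : Type*} [AddCommGroup P] [Module S P] (c : C)
    (φ : CharacterModule (CharacterModule P)) (χ : CharacterModule (BalancedTensor R S C P)) :
    btDoubleDual R S C P (bt R S c φ) χ = φ (btCharCurry χ c) :=
  DFunLike.congr_fun (btLiftₗ_bt (R := R) _ _ _ c φ) χ

/-- Characters of `C ⊗ P` are the maps `C → P⁺`. A tensor killed by the comparison thus annihilates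
all these maps, and finite presentation writes it through relations of `C`. For surjectivity, a map
`C → P⁺` is determined by its values on `n` generators, so a character of `(C ⊗ P)⁺` extends to
`(P⁺)ⁿ`. -/
theorem btDoubleDual_bijective [Module.FinitePresentation Sᵐᵒᵖ C] (P : Type*) [AddCommGroup P]
    [Module S P] : Function.Bijective (btDoubleDual R S C P) := by
  classical
  obtain ⟨n, x, hx⟩ := exists_fin_span_eq_top S C
  constructor
  · rw [injective_iff_map_eq_zero]
    intro t ht
    obtain ⟨φ, rfl⟩ := exists_fin_bt hx t
    obtain ⟨m, κ, q, hκ, hq⟩ := exists_relations_of_forall_hom hx φ (fun f => by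
      have := DFunLike.congr_fun ht (btChar R f)
      rw [map_sum, char_sum_apply] at this
      simp only [btDoubleDual_bt, char_zero_apply] at this
      rw [← this]
      refine Finset.sum_congr rfl fun i _ => congrArg (φ i) (CharacterModule.ext _ fun p => ?_)
      rw [btCharCurry_apply, btChar_bt])
    simp only [hq]
    exact sum_bt_relations hκ _
  · intro Ψ
    let ν : CharacterModule (BalancedTensor R S C P) →+ (Fin n → CharacterModule P) :=
      AddMonoidHom.mk' (fun χ i => btCharCurry χ (x i)) fun χ χ' => rfl
    obtain ⟨Ω, hΩ⟩ := exists_char_factor ν Ψ (fun χ hχ => by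
      have h0 : btCharCurry χ = 0 := LinearMap.ext_on_range hx fun i => by
        exact congrFun hχ i
      have : χ = 0 := by
        rw [← btChar_btCharCurry χ, h0]
        exact bt_hom_ext (g := 0) fun c p => btChar_bt R _ c p
      rw [this, map_zero])
    refine ⟨∑ i, bt R S (x i)
      (AddMonoidHom.comp Ω (AddMonoidHom.single (fun _ : Fin n => CharacterModule P) i) :
        CharacterModule (CharacterModule P)), CharacterModule.ext _ fun χ => ?_⟩
    rw [map_sum, char_sum_apply, ← hΩ, ← Finset.univ_sum_single (ν χ), map_sum]
    exact Finset.sum_congr rfl fun i _ => btDoubleDual_bt _ _ _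

variable (R S C) in
/-- The map `c ↦ c ⊗ p`. -/
def btRight {P : Type*} [AddCommGroup P] [Module S P] (p : P) : C →ₗ[R] BalancedTensor R S C P where
  toFun c := bt R S c p
  map_add' c c' := bt_add_left R S c c' p
  map_smul' r c := bt_smul_left R S r c p

@[simp] lemma btRight_apply {P : Type*} [AddCommGroup P] [Module S P] (p : P) (c : C) :
    btRight R S C p c = bt R S c p := rfl

/-- Maps from a finitely presented module to `C ⊗ P` with `P` flat factor through finite powers
of `C`. -/
theorem IsFlat.exists_factor {P L : Type u} [AddCommGroup P] [Module S P] [AddCommGroup L]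
    [Module R L] [Module.FinitePresentation R L] (hP : IsFlat S P)
    (g : L →ₗ[R] BalancedTensor R S C P) :
    ∃ (m : ℕ) (f : Fin m → L →ₗ[R] C) (q : Fin m → P), g = ∑ l, btRight R S C (q l) ∘ₗ f l := by
  classical
  obtain ⟨n, K, e, hK⟩ := Module.FinitePresentation.exists_fin R L
  obtain ⟨b, r, hr⟩ := Submodule.fg_iff_exists_fin_generating_family.1 hK
  let π : (Fin n → R) →ₗ[R] L := e.symm.toLinearMap ∘ₗ K.mkQ
  have hπ : Function.Surjective π := e.symm.surjective.comp K.mkQ_surjective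
  have hπr : ∀ v, π v = 0 ↔ v ∈ Submodule.span R (Set.range r) := fun v => by
    rw [hr]; simp [π]
  choose N c p hcp using fun i => exists_sum_bt R S (g (π (Pi.single i 1)))
  -- The `b` relations of `L` are collected into one vanishing tensor in `Cᵇ ⊗ P`, so that a single
  -- use of the flatness criterion solves all of them with the same `κ` and `q`.
  let nvec : (Σ i, Fin (N i)) → Fin b → C := fun k j => r j k.1 • c k.1 k.2
  let pvec : (Σ i, Fin (N i)) → P := fun k => p k.1 k.2
  have hpi : ∀ v : Fin n → R, ∑ i, v i • π (Pi.single i 1) = π v := fun v => by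
    simp only [← map_smul, ← map_sum]
    congr 1
    conv_rhs => rw [← Finset.univ_sum_single v]
    simp [← Pi.single_smul]
  have hrel : ∀ j, ∑ k : (Σ i, Fin (N i)), bt R S (nvec k j) (pvec k) = 0 := by
    intro j
    have h0 : π (r j) = 0 := (hπr _).2 (Submodule.subset_span ⟨j, rfl⟩)
    rw [← hpi] at h0
    have := congrArg g h0
    rw [map_zero, map_sum] at this
    simp only [map_smul, hcp, Finset.smul_sum, ← bt_smul_left] at this
    rw [Fintype.sum_sigma]
    exact this
  let inc : Fin b → BalancedTensor R S C P →+ BalancedTensor R S (Fin b → C) P := fun j =>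
    btLift R ((btHom R S).comp (AddMonoidHom.single (fun _ : Fin b => C) j)) (fun c s p => by
      simp only [AddMonoidHom.comp_apply, ← btHom_balanced]
      congr 2
      ext j'
      simp [Pi.single_apply])
  have hsum : ∑ k, bt R S (nvec k) (pvec k) = 0 := by
    have h1 : ∀ k, bt R S (nvec k) (pvec k) = ∑ j, inc j (bt R S (nvec k j) (pvec k)) := by
      intro k
      conv_lhs => rw [← Finset.univ_sum_single (nvec k), bt_sum_left]
      exact Finset.sum_congr rfl fun j _ => by simp [inc]
    simp only [h1]
    rw [Finset.sum_comm]
    simp only [← map_sum, hrel, map_zero, Finset.sum_const_zero]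
  obtain ⟨m, κ, q, hκ, hq⟩ := hP.exists_relations nvec pvec hsum
  -- The values of `f l` on the generators of `L`. That `κ l` is a relation in `Cᵇ` says exactly
  -- that these values respect the relations of `L`.
  let y : Fin m → Fin n → C := fun l i => ∑ a, MulOpposite.op (κ l ⟨i, a⟩) • c i a
  have hy : ∀ l v, π v = 0 → Fintype.linearCombination R (y l) v = 0 := by
    intro l v hv
    rw [hπr] at hv
    rw [← LinearMap.mem_ker]
    refine (Submodule.span_le.2 ?_) hv
    rintro _ ⟨j, rfl⟩
    have := congrFun (hκ l) j
    rw [Fintype.sum_sigma, Finset.sum_apply] at this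
    simp only [SetLike.mem_coe, LinearMap.mem_ker, Fintype.linearCombination_apply, y,
      Finset.smul_sum]
    simpa [nvec, smul_comm] using this
  choose f hf using fun l => exists_linearMap_factor hπ (Fintype.linearCombination R (y l)) (hy l)
  refine ⟨m, f, q, LinearMap.ext fun t => ?_⟩
  obtain ⟨v, rfl⟩ := hπ t
  rw [← hpi, map_sum, map_sum]
  refine Finset.sum_congr rfl fun i _ => ?_
  rw [map_smul, map_smul, hcp]
  congr 1
  have hq' : ∀ a, p i a = ∑ l, κ l ⟨i, a⟩ • q l := fun a => hq ⟨i, a⟩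
  simp only [LinearMap.sum_apply, LinearMap.comp_apply, btRight_apply, hf,
    Fintype.linearCombination_apply_single, one_smul, hq', bt_sum_right, ← bt_balanced, y, bt_sum_left]
  rw [Finset.sum_comm]

/-- After factoring through a finite power of `C`, only finitely many elements of `Q` have to be
lifted to `F`. -/
lemma IsFlat.exists_lift {F Q L : Type u} [AddCommGroup F] [Module S F] [AddCommGroup Q]
    [Module S Q] [AddCommGroup L] [Module R L] [Module.FinitePresentation R L] (hQ : IsFlat S Q)
    {g : F →ₗ[S] Q} (hg : Function.Surjective g) (k : L →ₗ[R] BalancedTensor R S C Q) :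
    ∃ h : L →ₗ[R] BalancedTensor R S C F, btMap R C g ∘ₗ h = k := by
  obtain ⟨m, f, q, rfl⟩ := hQ.exists_factor k
  choose p hp using fun l => hg (q l)
  refine ⟨∑ l, btRight R S C (p l) ∘ₗ f l, LinearMap.ext fun x => ?_⟩
  simp [hp]

end FinitePresentation

/-! ### Pure exactness and pure injective modules -/

section PureInjective

variable {R : Type u} [Ring R]

/-- Pure monomorphisms stay injective after tensoring. -/
lemma IsPureShortExact.btMap_injective {E : ShortComplex (ModuleCat.{u} R)}
    (hE : IsPureShortExact E) (X : Type u) [AddCommGroup X] [Module Rᵐᵒᵖ X] :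
    Function.Injective (btMap (S := R) ℤ X E.f.hom) := by
  classical
  rw [injective_iff_map_eq_zero]
  intro t ht
  have hX : Submodule.span Rᵐᵒᵖ (Set.range (id : X → X)) = ⊤ := by simp
  obtain ⟨p, rfl⟩ := exists_finsupp_bt hX t
  have ht' : ((p.mapRange E.f.hom (map_zero _)).sum fun i p => bt ℤ R (id i) p) = 0 := by
    rw [Finsupp.sum_mapRange_index (by simp), ← ht, Finsupp.sum, Finsupp.sum, map_sum]
    simp
  obtain ⟨m, κ, q, hκ, hq⟩ := exists_relations_of_sum_bt_eq_zero hX _ ht'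
  let J := Finset.univ.biUnion fun l => (κ l).support
  let row : X → Fin m → R := fun x l => κ l x
  have hrow : ∀ x ∉ J, row x = 0 := fun x hx => by
    ext l
    by_contra h
    exact hx (Finset.mem_biUnion.2 ⟨l, Finset.mem_univ l, Finsupp.mem_support_iff.2 h⟩)
  -- The rows of `κ` present a finitely presented module. The images of the `q l` in `E.X₃` satisfy
  -- these relations, so purity gives a solution `q'` of the homogeneous system in `E.X₂`. The
  -- differences `q l - q' l` then come from `E.X₁`.
  let K : Submodule R (Fin m → R) := Submodule.span R (row '' J)
  have hK : K.FG := Submodule.fg_span (J.finite_toSet.image _)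
  have hfp : Module.FinitePresentation R ((Fin m → R) ⧸ K) :=
    Module.finitePresentation_of_surjective K.mkQ K.mkQ_surjective (by rwa [Submodule.ker_mkQ])
  have hp : ∀ x, E.f.hom (p x) = ∑ l, κ l x • q l := fun x => by
    have := DFunLike.congr_fun hq x
    simpa [Finsupp.finsetSum_apply] using this
  let k₀ : (Fin m → R) →ₗ[R] E.X₃ := Fintype.linearCombination R fun l => E.g.hom (q l)
  have hk₀ : K ≤ LinearMap.ker k₀ := by
    refine Submodule.span_le.2 ?_
    rintro _ ⟨x, _, rfl⟩
    have h := congrArg E.g.hom (hp x)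
    rw [map_sum] at h
    simp only [map_smul] at h
    exact h.symm.trans (E.moduleCat_zero_apply (p x))
  obtain ⟨h, hh⟩ := hE.2 (ModuleCat.of R ((Fin m → R) ⧸ K)) hfp (ModuleCat.ofHom (K.liftQ k₀ hk₀))
  let q' : Fin m → E.X₂ := fun l => h.hom (K.mkQ (Pi.single l 1))
  have hq' : ∀ l, E.g.hom (q' l) = E.g.hom (q l) := fun l => by
    have := DFunLike.congr_fun (congrArg ModuleCat.Hom.hom hh) (K.mkQ (Pi.single l 1))
    refine this.trans ?_
    change k₀ (Pi.single l 1) = _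
    simp [k₀, Fintype.linearCombination_apply_single]
  have hrel : ∀ x, ∑ l, κ l x • q' l = 0 := fun x => by
    have h1 : K.mkQ (row x) = 0 := by
      rw [Submodule.mkQ_apply, Submodule.Quotient.mk_eq_zero]
      by_cases hx : x ∈ J
      · exact Submodule.subset_span ⟨x, hx, rfl⟩
      · rw [hrow x hx]
        exact K.zero_mem
    have h2 : K.mkQ (row x) = ∑ l, κ l x • K.mkQ (Pi.single l 1) := by
      simp only [← map_smul, ← map_sum]
      congr 1
      conv_lhs => rw [← Finset.univ_sum_single (row x)]
      simp [row, ← Pi.single_smul]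
    rw [h1] at h2
    have h3 := congrArg h.hom h2
    rw [map_sum, map_zero] at h3
    simp only [map_smul] at h3
    exact h3.symm
  have ha : ∀ l, ∃ a : E.X₁, E.f.hom a = q l - q' l := fun l =>
    (ShortComplex.moduleCat_exact_iff E).1 hE.1.exact _ (by
      change E.g.hom _ = 0
      rw [map_sub, hq', sub_self])
  choose a ha using ha
  have hpa : p = ∑ l, colSMul R (κ l) (a l) := by
    ext x
    rw [Finsupp.finsetSum_apply]
    simp only [colSMul_apply]
    apply hE.1.moduleCat_injective_f
    change E.f.hom _ = E.f.hom _
    rw [hp, map_sum]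
    simp only [map_smul, ha, smul_sub, Finset.sum_sub_distrib, hrel, sub_zero]
  rw [hpa, ← Finsupp.sum_finsetSum_index (by simp) (fun x => bt_add_right ℤ R (id x))]
  refine Finset.sum_eq_zero fun l _ => ?_
  rw [sum_colSMul_bt, hκ, bt_zero_left]

/-- Character modules are pure injective. -/
theorem pureInjective_characterModule (X : Type u) [AddCommGroup X] [Module Rᵐᵒᵖ X] :
    pureInjective R (ModuleCat.of R (CharacterModule X)) := by
  intro E hE g
  -- A map `E.X₁ → X⁺` is a character of `X ⊗ E.X₁`, which extends along the injection into `X ⊗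
  -- E.X₂`.
  let χ : CharacterModule (BalancedTensor ℤ R X E.X₁) :=
    btLift ℤ (AddMonoidHom.mk' (fun x => AddMonoidHom.mk' (fun a => g.hom a x)
      fun a b => by rw [map_add]; rfl) fun x y => by ext a; exact map_add (g.hom a) x y)
      fun x r a => (DFunLike.congr_fun (map_smul g.hom r a) x).symm
  have hχ : ∀ x a, χ (bt ℤ R x a) = g.hom a x := fun x a => btLift_bt _ _ x a
  obtain ⟨ψ, hψ⟩ := CharacterModule.dual_surjective_of_injective _ (hE.btMap_injective X) χ
  let h : E.X₂ →ₗ[R] CharacterModule X :=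
    { toFun := fun b => AddMonoidHom.mk' (fun x => ψ (bt ℤ R x b)) fun x y => by
        rw [bt_add_left, map_add]
      map_add' := fun b b' => CharacterModule.ext _ fun x =>
        (congrArg ψ (bt_add_right ℤ R x b b')).trans (map_add ψ _ _)
      map_smul' := fun r b => CharacterModule.ext _ fun x =>
        congrArg ψ (bt_balanced ℤ R x r b).symm }
  refine ⟨ModuleCat.ofHom h,
    ModuleCat.hom_ext (LinearMap.ext fun a => CharacterModule.ext _ fun x => ?_)⟩
  rw [← hχ, ← hψ]
  exact congrArg ψ (btMap_bt E.f.hom x a).symm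

lemma pureInjective_of_retract {M N : ModuleCat.{u} R} (hN : pureInjective R N) (i : M ⟶ N)
    (r : N ⟶ M) (h : i ≫ r = 𝟙 M) : pureInjective R M := by
  intro E hE g
  obtain ⟨k, hk⟩ := hN E hE (g ≫ i)
  exact ⟨k ≫ r, by rw [← Category.assoc, hk, Category.assoc, h, Category.comp_id]⟩

lemma pureInjective_of_linearEquiv {M N : Type u} [AddCommGroup M] [Module R M] [AddCommGroup N]
    [Module R N] (e : M ≃ₗ[R] N) (hN : pureInjective R (ModuleCat.of R N)) :
    pureInjective R (ModuleCat.of R M) :=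
  pureInjective_of_retract hN (ModuleCat.ofHom e.toLinearMap) (ModuleCat.ofHom e.symm.toLinearMap)
    (ModuleCat.hom_ext (LinearMap.ext fun x => e.symm_apply_apply x))

end PureInjective

/-! ### Pure sequences of `C`-flat modules and the cogenerator -/

section PureSequence

variable {R S C : Type u} [Ring R] [Ring S] [AddCommGroup C] [Module R C]
  [Module Sᵐᵒᵖ C] [SMulCommClass R Sᵐᵒᵖ C]

theorem pureInjective_bt_doubleDual [Module.FinitePresentation Sᵐᵒᵖ C] (P : Type u)
    [AddCommGroup P] [Module S P] :
    pureInjective R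
      (ModuleCat.of R (BalancedTensor R S C (CharacterModule (CharacterModule P)))) :=
  pureInjective_of_linearEquiv (LinearEquiv.ofBijective _ (btDoubleDual_bijective P))
    (pureInjective_characterModule _)

variable {K F Q : Type u} [AddCommGroup K] [Module S K] [AddCommGroup F] [Module S F]
  [AddCommGroup Q] [Module S Q] {i : K →ₗ[S] F} {g : F →ₗ[S] Q}

variable (R C) in
/-- The complex `C ⊗ K ⟶ C ⊗ F ⟶ C ⊗ Q`. -/
noncomputable def btComplex (hg : Function.Surjective g) (hex : Function.Exact i g) :
    ShortComplex (ModuleCat.{u} R) :=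
  ShortComplex.moduleCatMk (btMap R C i) (btMap R C g)
    (LinearMap.ext fun t => (btMap_exact hg hex).apply_apply_eq_zero t)

lemma moduleCatMk_shortExact {A B D : Type u} [AddCommGroup A] [Module R A] [AddCommGroup B]
    [Module R B] [AddCommGroup D] [Module R D] {f : A →ₗ[R] B} {g : B →ₗ[R] D}
    (hf : Function.Injective f) (hg : Function.Surjective g) (hex : Function.Exact f g) :
    (ShortComplex.moduleCatMk f g hex.linearMap_comp_eq_zero).ShortExact where
  exact := (ShortComplex.ShortExact.moduleCat_exact_iff_function_exact _).2 hex
  mono_f := (ModuleCat.mono_iff_injective _).2 hf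
  epi_g := (ModuleCat.epi_iff_surjective _).2 hg

/-- Tensoring a short exact sequence with flat cokernel gives a pure short exact sequence. -/
theorem IsFlat.isPureShortExact_btComplex (hQ : IsFlat S Q) (hi : Function.Injective i)
    (hg : Function.Surjective g) (hex : Function.Exact i g) :
    IsPureShortExact (btComplex R C hg hex) :=
  ⟨moduleCatMk_shortExact (hQ.btMap_injective hi hg hex) (btMap_surjective hg) (btMap_exact hg hex),
    fun M _ k => by
      obtain ⟨h, hh⟩ := hQ.exists_lift hg k.hom
      exact ⟨ModuleCat.ofHom h, ModuleCat.hom_ext hh⟩⟩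

lemma cFlat_bt {P : Type u} [AddCommGroup P] [Module S P] (hP : IsFlat S P) :
    cFlat R S C (ModuleCat.of R (BalancedTensor R S C P)) :=
  ⟨ModuleCat.of S P, hP, ⟨LinearEquiv.refl _ _⟩⟩

/-- `C ⊗ P` embeds purely into `C ⊗ P⁺⁺` with `C`-flat cokernel. -/
theorem cFlat_isCogeneratorFor [Module.FinitePresentation Sᵐᵒᵖ C] (hS : IsRightCoherent S) :
    IsCogeneratorFor (cFlat R S C ⊓ pureInjective R) (cFlat R S C) := by
  refine ⟨inf_le_left, ?_⟩
  rintro X ⟨P, hP, ⟨e⟩⟩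
  have hPP := hS.isFlat_doubleDual hP
  have hQ := isFlat_doubleDual_quotient hPP
  have hg := (LinearMap.range (doubleDualEval S P)).mkQ_surjective
  have hex : Function.Exact (doubleDualEval S P) (LinearMap.range (doubleDualEval S P)).mkQ :=
    LinearMap.exact_map_mkQ_range _
  have hi := hQ.btMap_injective (R := R) (C := C) doubleDualEval_injective hg hex
  have hex' : Function.Exact (btMap R C (doubleDualEval S P) ∘ₗ e.toLinearMap)
      (btMap R C (LinearMap.range (doubleDualEval S P)).mkQ) := by
    intro t
    rw [btMap_exact hg hex t]
    constructor
    · rintro ⟨s, rfl⟩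
      exact ⟨e.symm s, by simp⟩
    · rintro ⟨s, rfl⟩
      exact ⟨e s, rfl⟩
  have hse := moduleCatMk_shortExact
    (f := btMap R C (doubleDualEval S P) ∘ₗ e.toLinearMap) (hi.comp e.injective)
    (btMap_surjective hg) hex'
  exact ⟨_, _, _, _, _, hse, ⟨cFlat_bt hPP, pureInjective_bt_doubleDual P⟩, cFlat_bt hQ⟩

end PureSequence

/-! ### Dimension shifting and `Ext` out of direct sums -/

section ExtLemmas

variable {R : Type u} [Ring R] {E : ShortComplex (ModuleCat.{u} R)} {Y : ModuleCat.{u} R}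

lemma subsingleton_ext_of_iso {X X' : ModuleCat.{u} R} (e : X ≅ X') {n : ℕ}
    (h : Subsingleton (Ext X Y n)) : Subsingleton (Ext X' Y n) := by
  have key : ∀ x : Ext X' Y n, x = 0 := fun x => by
    rw [← Ext.mk₀_id_comp x, ← e.inv_hom_id, ← Ext.mk₀_comp_mk₀_assoc,
      Subsingleton.elim ((Ext.mk₀ e.hom).comp x (zero_add n)) 0, Ext.comp_zero]
  exact ⟨fun x y => by rw [key x, key y]⟩

lemma subsingleton_ext_of_iso_right {X Z : ModuleCat.{u} R} (e : Y ≅ Z) {n : ℕ}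
    (h : Subsingleton (Ext X Y n)) : Subsingleton (Ext X Z n) := by
  have key : ∀ x : Ext X Z n, x = 0 := fun x => by
    rw [← Ext.comp_mk₀_id x, ← e.inv_hom_id, ← Ext.mk₀_comp_mk₀,
      ← Ext.comp_assoc_of_third_deg_zero,
      Subsingleton.elim (x.comp (Ext.mk₀ e.inv) (add_zero n)) 0, Ext.zero_comp]
  exact ⟨fun x y => by rw [key x, key y]⟩

lemma subsingleton_ext_X₃ (hE : E.ShortExact) {n : ℕ} (h₁ : Subsingleton (Ext E.X₁ Y n))
    (h₂ : Subsingleton (Ext E.X₂ Y (n + 1))) : Subsingleton (Ext E.X₃ Y (n + 1)) := by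
  have key : ∀ x : Ext E.X₃ Y (n + 1), x = 0 := fun x => by
    obtain ⟨y, rfl⟩ := Ext.contravariant_sequence_exact₃ hE Y x (Subsingleton.elim _ _)
      (add_comm 1 n)
    rw [Subsingleton.elim y 0, Ext.comp_zero]
  exact ⟨fun x y => by rw [key x, key y]⟩

lemma subsingleton_ext_X₁ (hE : E.ShortExact) {n : ℕ} (h₂ : Subsingleton (Ext E.X₂ Y n))
    (h₃ : Subsingleton (Ext E.X₃ Y (n + 1))) : Subsingleton (Ext E.X₁ Y n) := by
  have key : ∀ x : Ext E.X₁ Y n, x = 0 := fun x => by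
    obtain ⟨y, rfl⟩ := Ext.contravariant_sequence_exact₁ hE Y x (add_comm 1 n)
      (Subsingleton.elim _ _)
    rw [Subsingleton.elim y 0, Ext.comp_zero]
  exact ⟨fun x y => by rw [key x, key y]⟩

/-- Every class is the connecting image of a map `E.X₁ ⟶ Y`, and the connecting map kills those that
extend to `E.X₂`. Extension properties from purity or factorization enter the `Ext` computations
here. -/
lemma subsingleton_ext_one_of_extend (hE : E.ShortExact) (h₂ : Subsingleton (Ext E.X₂ Y 1))
    (h : ∀ f : E.X₁ ⟶ Y, ∃ k : E.X₂ ⟶ Y, E.f ≫ k = f) : Subsingleton (Ext E.X₃ Y 1) := by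
  have key : ∀ x : Ext E.X₃ Y 1, x = 0 := fun x => by
    obtain ⟨y, rfl⟩ := Ext.contravariant_sequence_exact₃ hE Y x (Subsingleton.elim _ _)
      (add_zero 1)
    obtain ⟨f, rfl⟩ := Ext.addEquiv₀.symm.surjective y
    obtain ⟨k, rfl⟩ := h f
    change hE.extClass.comp (Ext.mk₀ (E.f ≫ k)) _ = 0
    rw [← Ext.mk₀_comp_mk₀]
    exact hE.extClass_comp_assoc _
  exact ⟨fun x y => by rw [key x, key y]⟩

lemma exists_extend_of_subsingleton_ext (hE : E.ShortExact) (h : Subsingleton (Ext E.X₃ Y 1))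
    (f : E.X₁ ⟶ Y) : ∃ k : E.X₂ ⟶ Y, E.f ≫ k = f := by
  obtain ⟨y, hy⟩ := Ext.contravariant_sequence_exact₁ hE Y (Ext.mk₀ f) (add_zero 1)
    (Subsingleton.elim _ _)
  obtain ⟨k, rfl⟩ := Ext.addEquiv₀.symm.surjective y
  refine ⟨k, (Ext.mk₀_bijective _ _).1 ?_⟩
  rw [← hy, ← Ext.mk₀_comp_mk₀]
  rfl

lemma exists_linearMap_extend_of_subsingleton_ext (hE : E.ShortExact)
    (h : Subsingleton (Ext E.X₃ Y 1)) (f : E.X₁ →ₗ[R] Y) :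
    ∃ k : E.X₂ →ₗ[R] Y, k ∘ₗ E.f.hom = f := by
  obtain ⟨k, hk⟩ := exists_extend_of_subsingleton_ext hE h (ModuleCat.ofHom f)
  exact ⟨k.hom, congrArg ModuleCat.Hom.hom hk⟩

lemma finsupp_shortExact (hE : E.ShortExact) (ι : Type u) :
    (ShortComplex.moduleCatMk (Finsupp.mapRange.linearMap (α := ι) E.f.hom)
      (Finsupp.mapRange.linearMap (α := ι) E.g.hom) (LinearMap.ext fun x => Finsupp.ext fun i =>
        E.moduleCat_zero_apply (x i))).ShortExact :=
  moduleCatMk_shortExact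
    (Finsupp.mapRange_injective _ (map_zero _) hE.moduleCat_injective_f)
    (Finsupp.mapRange_surjective _ (map_zero _) hE.moduleCat_surjective_g) (by
      have hex := (ShortComplex.ShortExact.moduleCat_exact_iff_function_exact E).1 hE.exact
      have hker : LinearMap.ker E.f.hom = ⊥ := LinearMap.ker_eq_bot.2 hE.moduleCat_injective_f
      rw [LinearMap.exact_iff, Finsupp.ker_mapRange, Finsupp.range_mapRange_linearMap _ hker]
      congr 1
      exact funext fun _ => LinearMap.exact_iff.1 hex)

/-- Vanishing of all higher `Ext` groups passes to direct sums of copies in the first variable. -/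
theorem subsingleton_ext_finsupp (ι : Type u) (n : ℕ) : ∀ L : ModuleCat.{u} R,
    (∀ k, Subsingleton (Ext L Y (k + 1))) →
      Subsingleton (Ext (ModuleCat.of R (ι →₀ L)) Y (n + 1)) := by
  induction n with
  | zero =>
    intro L hL
    have hE := ModuleCat.shortExact_projectiveShortComplex L
    have hproj : Projective (ModuleCat.of R (ι →₀ L.projectiveShortComplex.X₂)) :=
      (ModuleCat.of R _).projective_of_categoryTheory_projective
    refine subsingleton_ext_one_of_extend (finsupp_shortExact hE ι)
      (Ext.subsingleton_of_projective (ModuleCat.of R (ι →₀ L.projectiveShortComplex.X₂)) Y 0)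
      fun f => ?_
    choose k hk using fun i => exists_linearMap_extend_of_subsingleton_ext hE (hL 0)
        (f.hom ∘ₗ Finsupp.lsingle i)
    refine ⟨ModuleCat.ofHom (Finsupp.lsum ℕ k), ModuleCat.hom_ext ?_⟩
    refine Finsupp.lhom_ext' fun i => LinearMap.ext fun x => ?_
    refine Eq.trans ?_ (LinearMap.congr_fun (hk i) x)
    change Finsupp.lsum ℕ k (Finsupp.mapRange.linearMap _ (Finsupp.single i x)) = _
    rw [Finsupp.mapRange.linearMap_apply, Finsupp.mapRange_single, Finsupp.lsum_single]
    rfl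
  | succ n ih =>
    intro L hL
    have hE := ModuleCat.shortExact_projectiveShortComplex L
    have hproj : Projective (ModuleCat.of R (ι →₀ L.projectiveShortComplex.X₂)) :=
      (ModuleCat.of R _).projective_of_categoryTheory_projective
    have hproj' : Projective L.projectiveShortComplex.X₂ :=
      ModuleCat.projective_of_categoryTheory_projective _
    -- The induction hypothesis is used for the first syzygy of `L`, which inherits the vanishing by
    -- dimension shifting.
    exact subsingleton_ext_X₃ (finsupp_shortExact hE ι)
      (ih _ fun k => subsingleton_ext_X₁ hE (Ext.subsingleton_of_projective _ _ _) (hL (k + 1)))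
      (Ext.subsingleton_of_projective (ModuleCat.of R (ι →₀ L.projectiveShortComplex.X₂)) Y (n + 1))

end ExtLemmas

/-! ### Finitely presented syzygies -/

section Syzygies

variable {R : Type u} [Ring R]

/-- A module with a degreewise finite projective resolution has finitely presented syzygies. -/
lemma HasFiniteProjectiveResolution.exists_syzygies {M : Type u} [AddCommGroup M] [Module R M]
    (h : HasFiniteProjectiveResolution R M) :
    ∃ L : ℕ → ModuleCat.{u} R, (∀ n, Module.FinitePresentation R (L n)) ∧
      Nonempty (L 0 ≅ ModuleCat.of R M) ∧
      ∀ n, ∃ E : ShortComplex (ModuleCat.{u} R),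
        E.ShortExact ∧ Projective E.X₂ ∧ E.X₁ = L (n + 1) ∧ E.X₃ = L n := by
  obtain ⟨P, hP⟩ := h
  let d : ∀ n, P.complex.X (n + 1) →ₗ[R] P.complex.X n := fun n => (P.complex.d (n + 1) n).hom
  have hproj : ∀ n, Module.Projective R (P.complex.X n) := fun n => by
    have := P.projective n
    exact ModuleCat.projective_of_module_projective _
  have hdd : ∀ n x, d n (d (n + 1) x) = 0 := fun n x =>
    DFunLike.congr_fun (congrArg ModuleCat.Hom.hom (P.complex.d_comp_d (n + 2) (n + 1) n)) x
  have hex : ∀ n x, d n x = 0 → ∃ y, d (n + 1) y = x := fun n x hx =>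
    (ShortComplex.moduleCat_exact_iff _).1 (P.exact_succ n) x hx
  -- Syzygies are taken as cokernels, not kernels, of the differentials: finite presentation is then
  -- immediate. By exactness `d n` embeds the next cokernel in `P.complex.X n`.
  refine ⟨fun n => ModuleCat.of R (P.complex.X n ⧸ LinearMap.range (d n)), fun n => ?_, ⟨?_⟩,
    fun n => ?_⟩
  · have := Module.finitePresentation_of_projective R (P.complex.X n)
    refine Module.finitePresentation_of_surjective (LinearMap.range (d n)).mkQ
      (Submodule.mkQ_surjective _) ?_
    rw [Submodule.ker_mkQ]
    exact Module.Finite.iff_fg.1 inferInstance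
  · exact (ModuleCat.cokernelIsColimit (P.complex.d 1 0)).coconePointUniqueUpToIso
      P.isColimitCokernelCofork ≪≫ 
        HomologicalComplex.singleObjXSelf (ComplexShape.down ℕ) 0 (ModuleCat.of R M)
  · refine ⟨ShortComplex.moduleCatMk ((LinearMap.range (d (n + 1))).liftQ (d n) ?_)
      (LinearMap.range (d n)).mkQ ?_, moduleCatMk_shortExact ?_ (Submodule.mkQ_surjective _) ?_,
      P.projective n, rfl, rfl⟩
    · rintro _ ⟨x, rfl⟩
      exact hdd n x
    · ext x
      exact (Submodule.Quotient.mk_eq_zero _).2 ⟨x, rfl⟩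
    · rw [← LinearMap.ker_eq_bot, Submodule.ker_liftQ_eq_bot']
      refine le_antisymm ?_ ?_
      · rintro _ ⟨x, rfl⟩
        exact hdd n x
      · exact fun x hx => hex n x hx
    · rw [LinearMap.exact_iff, Submodule.ker_mkQ, Submodule.range_liftQ]

lemma HasFiniteProjectiveResolution.finitePresentation {M : Type u} [AddCommGroup M] [Module R M]
    (h : HasFiniteProjectiveResolution R M) : Module.FinitePresentation R M := by
  obtain ⟨L, hL, ⟨e⟩, _⟩ := h.exists_syzygies
  exact (hL 0).of_equiv e.toLinearEquiv

end Syzygies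

/-! ### Vanishing of `Ext` between `C`-flat modules -/

section CFlatExt

variable {R S C : Type u} [Ring R] [Ring S] [AddCommGroup C] [Module R C]
  [Module Sᵐᵒᵖ C] [SMulCommClass R Sᵐᵒᵖ C]

/-- If `M` has a degreewise finite resolution and `Ext^i(M, C) = 0` for `i ≥ 1`, then
`Ext^i(M, C ⊗ P) = 0` for `i ≥ 1` and `P` flat. -/
theorem IsFlat.subsingleton_ext_bt {M P : Type u} [AddCommGroup M] [Module R M] [AddCommGroup P]
    [Module S P] (hP : IsFlat S P) (hM : HasFiniteProjectiveResolution R M)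
    (hext : ∀ k, Subsingleton (Ext (ModuleCat.of R M) (ModuleCat.of R C) (k + 1))) (k : ℕ) :
    Subsingleton (Ext (ModuleCat.of R M) (ModuleCat.of R (BalancedTensor R S C P)) (k + 1)) := by
  obtain ⟨L, hL, ⟨e⟩, hE⟩ := hM.exists_syzygies
  have hLC : ∀ n k, Subsingleton (Ext (L n) (ModuleCat.of R C) (k + 1)) := by
    intro n
    induction n with
    | zero => exact fun k => subsingleton_ext_of_iso e.symm (hext k)
    | succ n ih =>
      intro k
      obtain ⟨E, hE, hproj, h₁, h₃⟩ := hE n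
      rw [← h₁]
      exact subsingleton_ext_X₁ hE (Ext.subsingleton_of_projective _ _ _) (h₃ ▸ ih (k + 1))
  suffices h : ∀ k n, Subsingleton
      (Ext (L n) (ModuleCat.of R (BalancedTensor R S C P)) (k + 1)) from
    subsingleton_ext_of_iso e (h k 0)
  intro k
  induction k with
  | zero =>
    intro n
    obtain ⟨E, hE, hproj, h₁, h₃⟩ := hE n
    rw [← h₃]
    refine subsingleton_ext_one_of_extend hE (Ext.subsingleton_of_projective _ _ _) fun f => ?_
    have : Module.FinitePresentation R E.X₁ := h₁ ▸ hL (n + 1)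
    -- The syzygy `E.X₁` is finitely presented, so `f` factors through a power of `C`. Each
    -- component extends to `E.X₂` because `Ext¹(L n, C)` vanishes.
    obtain ⟨m, a, q, hf⟩ := hP.exists_factor f.hom
    choose b hb using fun l => exists_linearMap_extend_of_subsingleton_ext
      (Y := ModuleCat.of R C) hE (h₃ ▸ hLC n 0) (a l)
    refine ⟨ModuleCat.ofHom (∑ l, btRight R S C (q l) ∘ₗ b l), ModuleCat.hom_ext ?_⟩
    rw [hf]
    refine LinearMap.ext fun x => ?_
    simp [← hb]
  | succ k ih =>
    intro n
    obtain ⟨E, hE, hproj, h₁, h₃⟩ := hE n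
    rw [← h₃]
    exact subsingleton_ext_X₃ hE (h₁ ▸ ih (n + 1)) (Ext.subsingleton_of_projective _ _ _)

variable (R S C) in
/-- The map `c ⊗ v ↦ (c v i)ᵢ`. -/
noncomputable def btFinsuppHom (ι : Type*) : BalancedTensor R S C (ι →₀ S) →ₗ[R] (ι →₀ C) :=
  btLiftₗ R (AddMonoidHom.mk' (fun c => Finsupp.mapRange.addMonoidHom
      (AddMonoidHom.mk' (fun s : S => MulOpposite.op s • c) fun s t => by simp [add_smul]))
      fun c c' => by ext; simp)
    (fun c s v => by ext; simp [mul_smul])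
    (fun r c v => by ext; simp [smul_comm])

lemma btFinsuppHom_bt_single {ι : Type*} (c : C) (i : ι) (s : S) :
    btFinsuppHom R S C ι (bt R S c (Finsupp.single i s)) =
      Finsupp.single i (MulOpposite.op s • c) := by
  rw [btFinsuppHom, btLiftₗ_bt]
  simp

variable (R S C) in
/-- The inverse of `btFinsuppHom`. -/
noncomputable def btFinsuppInv (ι : Type*) : (ι →₀ C) →ₗ[R] BalancedTensor R S C (ι →₀ S) :=
  Finsupp.lsum ℕ fun i => btRight R S C (Finsupp.single i 1)

lemma btFinsuppInv_single {ι : Type*} (i : ι) (c : C) :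
    btFinsuppInv R S C ι (Finsupp.single i c) = bt R S c (Finsupp.single i 1) := by
  rw [btFinsuppInv, Finsupp.lsum_single, btRight_apply]

variable (R S C) in
/-- `C ⊗ S^(ι)` is `C^(ι)`. -/
noncomputable def btFinsupp (ι : Type*) : BalancedTensor R S C (ι →₀ S) ≃ₗ[R] (ι →₀ C) :=
  LinearEquiv.ofLinearMap (btFinsuppHom R S C ι) (btFinsuppInv R S C ι)
    (Finsupp.lhom_ext' fun i => LinearMap.ext fun c => by
      change btFinsuppHom R S C ι (btFinsuppInv R S C ι (Finsupp.single i c)) = Finsupp.single i c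
      rw [btFinsuppInv_single, btFinsuppHom_bt_single, MulOpposite.op_one, one_smul])
    (bt_linearMap_ext fun c v => by
      change btFinsuppInv R S C ι (btFinsuppHom R S C ι (bt R S c v)) = bt R S c v
      induction v using Finsupp.induction_linear with
      | zero => rw [bt_zero_right, map_zero, map_zero]
      | add v w hv hw => rw [bt_add_right, map_add, map_add, hv, hw]
      | single i s =>
        rw [btFinsuppHom_bt_single, btFinsuppInv_single, bt_balanced, Finsupp.smul_single,
          smul_eq_mul, mul_one])

/-- Higher `Ext` groups from `C`-flat modules to pure injective modules vanish as soon as those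
from `C` do. -/
theorem IsFlat.subsingleton_ext_of_pureInjective {M : ModuleCat.{u} R} (hM : pureInjective R M)
    (hext : ∀ k, Subsingleton (Ext (ModuleCat.of R C) M (k + 1))) (k : ℕ) :
    ∀ (Q : Type u) [AddCommGroup Q] [Module S Q], IsFlat S Q →
      Subsingleton (Ext (ModuleCat.of R (BalancedTensor R S C Q)) M (k + 1)) := by
  have hfree : ∀ (ι : Type u) (k : ℕ),
      Subsingleton (Ext (ModuleCat.of R (BalancedTensor R S C (ι →₀ S))) M (k + 1)) :=
    fun ι k => subsingleton_ext_of_iso (btFinsupp R S C ι).symm.toModuleIso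
      (subsingleton_ext_finsupp ι k (ModuleCat.of R C) hext)
  induction k with
  | zero =>
    intro Q _ _ hQ
    have hg : Function.Surjective (Finsupp.linearCombination S (id : Q → Q)) :=
      Finsupp.linearCombination_id_surjective S Q
    -- A free cover of the flat module `Q` becomes a pure sequence after tensoring with `C`, along
    -- which maps to `M` extend. Its middle term is a direct sum of copies of `C`.
    have hpure := hQ.isPureShortExact_btComplex (R := R) (C := C)
      (Submodule.injective_subtype _) hg (LinearMap.exact_subtype_ker_map _)
    exact subsingleton_ext_one_of_extend hpure.1 (hfree Q 0) (hM _ hpure)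
  | succ k ih =>
    intro Q _ _ hQ
    have hg : Function.Surjective (Finsupp.linearCombination S (id : Q → Q)) :=
      Finsupp.linearCombination_id_surjective S Q
    have hex := LinearMap.exact_subtype_ker_map (Finsupp.linearCombination S (id : Q → Q))
    have hpure := hQ.isPureShortExact_btComplex (R := R) (C := C)
      (Submodule.injective_subtype _) hg hex
    exact subsingleton_ext_X₃ hpure.1
      (ih _ (hQ.kernel (isFlat_finsupp Q) (Submodule.injective_subtype _) hg hex)) (hfree Q (k + 1))

/-- The target plays two roles: being `C`-flat gives the vanishing of `Ext` from `C`, and being pure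
injective spreads it to all `C`-flat sources. -/
lemma IsSemidualizing.extOrthogonal (hC : IsSemidualizing R S C) :
    ExtOrthogonal (cFlat R S C) (cFlat R S C ⊓ pureInjective R) := by
  rintro X Y ⟨Q, hQ, ⟨e⟩⟩ ⟨⟨P, hP, ⟨e'⟩⟩, hY⟩ i hi
  obtain ⟨k, rfl⟩ := Nat.exists_eq_add_of_le' hi
  exact subsingleton_ext_of_iso e.symm.toModuleIso
    (IsFlat.subsingleton_ext_of_pureInjective hY (fun k =>
      subsingleton_ext_of_iso_right e'.symm.toModuleIso
        (hP.subsingleton_ext_bt hC.finite_left (fun k => hC.ext_left _ (by lia)) k)) k Q hQ)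

end CFlatExt

/-! ### Small flat submodules and preenvelopes -/

/-- Formal generators of a submodule closed under solutions of vanishing tensors with
coefficients in `N`. -/
inductive PureGen (A N : Type u) : Type u
  | base (a : A) (i : ℕ) : PureGen A N
  | step (n : ℕ) (c : Fin n → N) (w : Fin n → PureGen A N) (l : ℕ) : PureGen A N

/-- The evaluation of formal generators for a choice of base values and of solutions. -/
def PureGen.eval {A N P : Type u} (b : A → ℕ → P)
    (q : ∀ n : ℕ, (Fin n → N) → (Fin n → P) → ℕ → P) : PureGen A N → P
  | .base a i => b a i
  | .step n c w l => q n c (fun k => (w k).eval b q) l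

section SmallFlat

variable {R S C : Type u} [Ring R] [Ring S] [AddCommGroup C] [Module R C]
  [Module Sᵐᵒᵖ C] [SMulCommClass R Sᵐᵒᵖ C]

lemma exists_common_coefficients {P W : Type*} [AddCommGroup P] [Module S P] {x : W → P}
    (hx : Submodule.span S (Set.range x) = ⊤) {n : ℕ} (p : Fin n → P) :
    ∃ (b : ℕ) (w : Fin b → W) (σ : Fin n → Fin b → S), ∀ k, p k = ∑ a, σ k a • x (w a) := by
  classical
  have h : ∀ k, ∃ v : W →₀ S, (v.sum fun i s => s • x i) = p k := fun k =>
    Finsupp.mem_span_range_iff_exists_finsupp.1 (hx ▸ Submodule.mem_top)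
  choose v hv using h
  let J := Finset.univ.biUnion fun k => (v k).support
  let e := J.equivFin
  refine ⟨J.card, fun a => e.symm a, fun k a => v k (e.symm a), fun k => ?_⟩
  rw [e.symm.sum_comp (fun j : J => v k j • x j), Finset.sum_coe_sort J fun j => v k j • x j, ← hv]
  exact Finsupp.sum_of_support_subset _
    (Finset.subset_biUnion_of_mem (fun k => (v k).support) (Finset.mem_univ k)) _ (by simp)

/-- Every map from `A` to `C ⊗ P` with `P` flat factors through `C ⊗ P₀` with `P₀` flat of size
bounded in terms of `A`, `C` and `S`. -/
theorem IsFlat.exists_small_factor {A P : Type u} [AddCommGroup A] [Module R A] [AddCommGroup P]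
    [Module S P] (hP : IsFlat S P) (f : A →ₗ[R] BalancedTensor R S C P) :
    ∃ K : Submodule S (PureGen A (C × S) →₀ S), IsFlat S ((PureGen A (C × S) →₀ S) ⧸ K) ∧
      ∃ (f₀ : A →ₗ[R] BalancedTensor R S C ((PureGen A (C × S) →₀ S) ⧸ K))
        (j : ((PureGen A (C × S) →₀ S) ⧸ K) →ₗ[S] P), btMap R C j ∘ₗ f₀ = f := by
  classical
  let W := PureGen A (C × S)
  choose n₀ c₀ p₀ hf using fun a => exists_sum_bt R S (f a)
  have hsol : ∀ (n : ℕ) (c : Fin n → C × S) (p : Fin n → P),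
      ∃ (m : ℕ) (κ : Fin m → Fin n → S) (q : ℕ → P), ∑ i, bt ℤ S (c i) (p i) = 0 →
        (∀ l, ∑ i, MulOpposite.op (κ l i) • c i = 0) ∧ ∀ i, p i = ∑ l, κ l i • q l := by
    intro n c p
    by_cases h : ∑ i, bt ℤ S (c i) (p i) = 0
    · obtain ⟨m, κ, q, hκ, hq⟩ := hP.exists_relations c p h
      -- Solutions are padded by zero to sequences indexed by `ℕ`, so that the formal generators
      -- need not know how many there are.
      exact ⟨m, κ, fun l => if h : l < m then q ⟨l, h⟩ else 0, fun _ => ⟨hκ, by simpa using hq⟩⟩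
    · exact ⟨0, Fin.elim0, 0, fun h' => absurd h' h⟩
  choose m κ q hq using hsol
  let ev : W → P := PureGen.eval (fun a i => if h : i < n₀ a then p₀ a ⟨i, h⟩ else 0) q
  let π : (W →₀ S) →ₗ[S] P := Finsupp.linearCombination S ev
  let K := LinearMap.ker π
  let j : ((W →₀ S) ⧸ K) →ₗ[S] P := K.liftQ π le_rfl
  have hj : Function.Injective j := LinearMap.ker_eq_bot.1 (Submodule.ker_liftQ_eq_bot _ _ _ le_rfl)
  let x : W → (W →₀ S) ⧸ K := fun w => K.mkQ (Finsupp.single w 1)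
  have hjx : ∀ w, j (x w) = ev w := fun w => by
    change π (Finsupp.single w 1) = ev w
    simp [π]
  have hx : Submodule.span S (Set.range x) = ⊤ := by
    have : Set.range x = K.mkQ '' Set.range (fun w => Finsupp.single w (1 : S)) := by
      rw [← Set.range_comp]
      rfl
    rw [this, ← Submodule.map_span, ← Finsupp.coe_basisSingleOne, Module.Basis.span_eq,
      Submodule.map_top, Submodule.range_mkQ]
  -- The quotient by `K` is the submodule of `P` spanned by all evaluated generators, and it is
  -- closed under solutions. Coefficients in `C × S` serve two purposes: the factor `S` gives
  -- flatness of this submodule, the factor `C` gives injectivity of its tensor product into `C ⊗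
  -- P`.
  have hrel : ∀ (n : ℕ) (c : Fin n → C × S) (p : Fin n → (W →₀ S) ⧸ K),
      ∑ k, bt ℤ S (c k) (j (p k)) = 0 →
        ∃ (m : ℕ) (κ : Fin m → Fin n → S) (q : Fin m → (W →₀ S) ⧸ K),
          (∀ l, ∑ i, MulOpposite.op (κ l i) • c i = 0) ∧ ∀ i, p i = ∑ l, κ l i • q l := by
    intro n c p h
    obtain ⟨b, w, σ, hσ⟩ := exists_common_coefficients hx p
    -- Moving the scalars to the left factor makes the right factors generators, so that a `step`
    -- generator supplies the solution.
    let d : Fin b → C × S := fun a => ∑ k, MulOpposite.op (σ k a) • c k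
    have hd : ∑ a, bt ℤ S (d a) (ev (w a)) = 0 := by
      rw [← h]
      simp only [d, hσ, map_sum, map_smul, hjx, bt_sum_left, bt_sum_right, bt_balanced]
      exact Finset.sum_comm
    obtain ⟨h1, h2⟩ := hq b d (fun a => ev (w a)) hd
    refine ⟨_, fun l k => ∑ a, σ k a * κ b d (fun a => ev (w a)) l a,
      fun l => x (PureGen.step b d w l), fun l => ?_, fun k => ?_⟩
    · rw [← h1 l]
      simp only [d, Finset.smul_sum, Finset.op_sum, Finset.sum_smul, MulOpposite.op_mul, mul_smul]
      exact Finset.sum_comm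
    · apply hj
      simp only [hσ, map_sum, map_smul, hjx, Finset.sum_smul, mul_smul]
      rw [Finset.sum_comm]
      refine Finset.sum_congr rfl fun a _ => ?_
      rw [← Finset.smul_sum]
      exact congrArg (σ k a • ·) (h2 a)
  have hflat : IsFlat S ((W →₀ S) ⧸ K) := by
    refine isFlat_of_exists_relations fun n s p hp => ?_
    obtain ⟨m, κ, q, hκ, hq⟩ := hrel n (fun k => (0, s k)) p (by
      have : ∀ k, bt ℤ S ((0, s k) : C × S) (j (p k)) = bt ℤ S ((0, 1) : C × S) (j (s k • p k)) :=
        fun k => by rw [map_smul, ← bt_balanced]; simp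
      simp only [this]
      rw [← bt_sum_right, ← map_sum, hp, map_zero, bt_zero_right])
    exact ⟨m, κ, q, fun l => by simpa [Prod.snd_sum] using congrArg Prod.snd (hκ l), hq⟩
  have hinj : Function.Injective (btMap R C j) := by
    rw [injective_iff_map_eq_zero]
    intro t ht
    obtain ⟨n, c, p, rfl⟩ := exists_sum_bt R S t
    obtain ⟨m, κ, q, hκ, hq⟩ := hrel n (fun k => (c k, 0)) p (by
      have h1 := congrArg (fun t => balancedTensorMap (LinearMap.inl Sᵐᵒᵖ C S) P (btForget R S t)) ht
      simpa using h1)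
    simp only [hq]
    exact sum_bt_relations (fun l => by simpa [Prod.fst_sum] using congrArg Prod.fst (hκ l)) q
  have hrange : ∀ a, f a ∈ LinearMap.range (btMap R C j) := fun a => by
    refine ⟨∑ k, bt R S (c₀ a k) (x (PureGen.base a k)), ?_⟩
    rw [map_sum, hf]
    refine Finset.sum_congr rfl fun k _ => ?_
    rw [btMap_bt, hjx]
    simp [ev, PureGen.eval]
  refine ⟨K, hflat, (LinearEquiv.ofInjective _ hinj).symm.toLinearMap ∘ₗ f.codRestrict _ hrange, j,
    LinearMap.ext fun a => ?_⟩
  have := LinearEquiv.apply_symm_apply (LinearEquiv.ofInjective _ hinj) (f.codRestrict _ hrange a)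
  exact congrArg Subtype.val this

/-- A weakly initial family of maps from `A` to `C`-flat modules yields a preenvelope. -/
lemma IsRightCoherent.exists_isPreenvelope_of_family [Module.FinitePresentation Sᵐᵒᵖ C]
    (hS : IsRightCoherent S) (A : ModuleCat.{u} R) {J : Type u} (Q : J → Type u)
    [∀ y, AddCommGroup (Q y)] [∀ y, Module S (Q y)] (hQ : ∀ y, IsFlat S (Q y))
    (a : ∀ y, A →ₗ[R] BalancedTensor R S C (Q y))
    (h : ∀ (P : ModuleCat.{u} S) (f : A →ₗ[R] BalancedTensor R S C P), IsFlat S P →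
      ∃ (y : J) (j : Q y →ₗ[S] P), btMap R C j ∘ₗ a y = f) :
    ∃ (X : ModuleCat.{u} R) (f : A ⟶ X), IsPreenvelope (cFlat R S C ⊓ pureInjective R) f := by
  have hbij := btPi_bijective (R := R) (S := S) (C := C) Q
  let b : A →ₗ[R] BalancedTensor R S C (∀ y, Q y) :=
    (LinearEquiv.ofBijective _ hbij).symm.toLinearMap ∘ₗ LinearMap.pi a
  have hb : ∀ y x, btMap R C (LinearMap.proj y) (b x) = a y x := fun y x =>
    congrFun (LinearEquiv.apply_symm_apply (LinearEquiv.ofBijective _ hbij) (LinearMap.pi a x)) y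
  have hPP := hS.isFlat_doubleDual (hS.isFlat_pi hQ)
  have hpure := (isFlat_doubleDual_quotient hPP).isPureShortExact_btComplex (R := R) (C := C)
    doubleDualEval_injective (Submodule.mkQ_surjective _) (LinearMap.exact_map_mkQ_range _)
  refine ⟨ModuleCat.of R (BalancedTensor R S C (CharacterModule (CharacterModule (∀ y, Q y)))),
    ModuleCat.ofHom (btMap R C (doubleDualEval S (∀ y, Q y)) ∘ₗ b),
    ⟨cFlat_bt hPP, pureInjective_bt_doubleDual _⟩, ?_⟩
  rintro D ⟨⟨P, hP, ⟨e⟩⟩, hD⟩ f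
  obtain ⟨y, j, hj⟩ := h P (e.toLinearMap ∘ₗ f.hom) hP
  let k : BalancedTensor R S C (∀ y, Q y) →ₗ[R] D :=
    e.symm.toLinearMap ∘ₗ btMap R C j ∘ₗ btMap R C (LinearMap.proj y)
  -- Projecting to the factor through which `f` passes gives a map from `C ⊗ ∏ Q`. Pure injectivity
  -- of `D` extends it to the double dual.
  obtain ⟨h, hh⟩ := hD _ hpure (ModuleCat.ofHom k)
  refine ⟨h, ModuleCat.hom_ext (LinearMap.ext fun x => ?_)⟩
  have h1 : h.hom (btMap R C (doubleDualEval S (∀ y, Q y)) (b x)) = k (b x) :=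
    LinearMap.congr_fun (congrArg ModuleCat.Hom.hom hh) (b x)
  have h2 : btMap R C j (a y x) = e (f.hom x) := LinearMap.congr_fun hj x
  refine h1.trans ?_
  change e.symm (btMap R C j (btMap R C (LinearMap.proj y) (b x))) = f.hom x
  rw [hb, h2, LinearEquiv.symm_apply_apply]

/-- Pure injective `C`-flat modules are preenveloping. -/
theorem cFlat_pureInjective_isPreenveloping [Module.FinitePresentation Sᵐᵒᵖ C]
    (hS : IsRightCoherent S) : IsPreenveloping (cFlat R S C ⊓ pureInjective R) := by
  intro A
  refine hS.exists_isPreenvelope_of_family A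
    -- All flat quotients of one fixed free module, together with all maps from `A`, form an index
    -- type in the universe `u`. This is the solution set.
    (J := {y : Σ K : Submodule S (PureGen A (C × S) →₀ S),
      A →ₗ[R] BalancedTensor R S C ((PureGen A (C × S) →₀ S) ⧸ K) //
        IsFlat S ((PureGen A (C × S) →₀ S) ⧸ y.1)})
    (fun y => (PureGen A (C × S) →₀ S) ⧸ y.1.1) (fun y => y.2) (fun y => y.1.2) fun P f hP => ?_
  obtain ⟨K, hK, f₀, j, hj⟩ := hP.exists_small_factor f
  exact ⟨⟨⟨K, f₀⟩, hK⟩, j, hj⟩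

end SmallFlat

/-! ### Comparison of the two classes and conclusion -/

/-- Over a right coherent ring, `C`-cotorsion and pure injective `C`-flat modules agree. -/
theorem IsSemidualizing.cFlat_inf_cCotorsion {R S C : Type u} [Ring R] [Ring S] [AddCommGroup C]
    [Module R C] [Module Sᵐᵒᵖ C] [SMulCommClass R Sᵐᵒᵖ C] (hS : IsRightCoherent S)
    (hC : IsSemidualizing R S C) :
    cFlat R S C ⊓ cCotorsion R S C = cFlat R S C ⊓ pureInjective R := by
  have := hC.finite_right.finitePresentation
  apply le_antisymm
  · intro D hD
    refine ⟨hD.1, ?_⟩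
    obtain ⟨E, D', f, g, w, hse, hE, hD'⟩ := (cFlat_isCogeneratorFor hS).2 D hD.1
    -- The cokernel `D'` is `C`-flat, so the cotorsion condition splits the sequence and `D` is a
    -- retract of the pure injective `E`.
    obtain ⟨r, hr⟩ := exists_extend_of_subsingleton_ext hse (hD.2 D' hD' 1 le_rfl) (𝟙 D)
    exact pureInjective_of_retract hE.2 f r hr
  · intro D hD
    exact ⟨hD.1, fun X hX i hi => hC.extOrthogonal X D hX hD i hi⟩

end Semidualizing

theorem proposition4p4 (R S C : Type u) [Ring R] [Ring S] [AddCommGroup C] [Module R C]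
    [Module Sᵐᵒᵖ C] [SMulCommClass R Sᵐᵒᵖ C]
    (hS : Semidualizing.IsRightCoherent S) (hC : Semidualizing.IsSemidualizing R S C) :
    (Semidualizing.cFlat R S C ⊓ Semidualizing.cCotorsion R S C =
      Semidualizing.cFlat R S C ⊓ Semidualizing.pureInjective R) ∧
    Semidualizing.IsInjectiveCogeneratorFor
      (Semidualizing.cFlat R S C ⊓ Semidualizing.pureInjective R) (Semidualizing.cFlat R S C) ∧
    (Semidualizing.IsFaithfullySemidualizing R S C →
      Semidualizing.IsPreenveloping
        (Semidualizing.cFlat R S C ⊓ Semidualizing.pureInjective R)) := by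
  have := hC.finite_right.finitePresentation
  exact ⟨hC.cFlat_inf_cCotorsion hS, ⟨Semidualizing.cFlat_isCogeneratorFor hS, hC.extOrthogonal⟩,
    fun _ => Semidualizing.cFlat_pureInjective_isPreenveloping hS⟩
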